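/- Let $d\in\mathbb N$, $1<p,q<\infty$, $0<s\le t<1$, $\alpha>0$, and suppose that $s-\frac dp<0$ and $tq>sp+\alpha$. Let $\Omega=(-1,1)^d$ and $3\Omega=(-3,3)^d$. For a nonnegative bounded measurable weight $a$ on $\mathbb R^d\times\mathbb R^d$ and a measurable $v:\mathbb R^d\to\mathbb R$ put $$\mathcal J(v)=\int_{\mathbb R^d}\int_{\mathbb R^d}\frac1p\,\frac{|v(x)-v(y)|^p}{|x-y|^{d+sp}}\,dx\,dy+\int_{\mathbb R^d}\int_{\mathbb R^d}\frac1q\,a(x,y)\,\frac{|v(x)-v(y)|^q}{|x-y|^{d+tq}}\,dx\,dy\in[0,\infty].$$ Let $W_0(\Omega)=\{v\in L^1_{\rm loc}(\mathbb R^d):\mathcal J(v)<\infty,\ v=0 \text{ a.e. on } \mathbb R^d\setminus\Omega\}$, let $H_0(\Omega)$ be the closure of $C_0^\infty(\Omega)$ in $W_0(\Omega)$ with respect to the Luxemburg norm $\|v\|_{\mathcal J}=\inf\{\lambda>0:\mathcal J(v/\lambda)\le1\}$, and for a function $u_D$ let $W_{u_D}(\Omega)=u_D+W_0(\Omega)$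 and $H_{u_D}(\Omega)=u_D+H_0(\Omega)$. Then there is a nonnegative, bounded, symmetric weight $a\in C^\alpha\cap L^\infty(\mathbb R^d\times\mathbb R^d)$, vanishing outside $3\Omega\times3\Omega$, for which the Lavrentiev gap occurs: there is $u_D\in C^\infty(\mathbb R^d)\cap L^\infty(\mathbb R^d)$ with $u_D=0$ outside $3\Omega$ such that $$\inf \mathcal J\big(W_{u_D}(\Omega)\big)<\inf\mathcal J\big(H_{u_D}(\Omega)\big).$$ Here $C^\alpha$ denotes the functions that are $k=\lfloor\alpha\rfloor$ times continuously differentiable, with bounded derivatives up to order $k$, and whose $k$-th derivative is globally Hölder continuous with exponent $\alpha-k$ (for integer $\alpha=k$ this last condition is just boundedness). -/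

import Mathlib

open MeasureTheory
open scoped ENNReal ContDiff

noncomputable section

namespace DoublePhase

/-- `ℝ^d` with its Euclidean norm. -/
abbrev E (d : ℕ) : Type := EuclideanSpace ℝ (Fin d)

/-- The open cube `(-r, r)^d`. The domain is `Ω = cube d 1`, and `3Ω = cube d 3`. -/
def cube (d : ℕ) (r : ℝ) : Set (E d) := {x | ∀ i, |x i| < r}

/-- The weighted fractional energy
`∫∫ (1/r) w(x,y) |v(x) - v(y)|^r / |x - y|^(d + σ r) dx dy`, with values in `[0, ∞]`
(for a nonnegative weight `w`). -/
def phase {d : ℕ} (σ r : ℝ) (w : E d × E d → ℝ) (v : E d → ℝ) : ℝ≥0∞ :=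
  ∫⁻ x, ∫⁻ y, ENNReal.ofReal
    (1 / r * w (x, y) * |v x - v y| ^ r / ‖x - y‖ ^ ((d : ℝ) + σ * r))

/-- The exponents `s, p` of the first phase and `t, q` of the second phase. -/
structure Exponents where
  s : ℝ
  p : ℝ
  t : ℝ
  q : ℝ

/-- The nonlocal double phase energy: the `(s,p)`-energy plus the `(t,q)`-energy
with weight `a`. -/
def energy {d : ℕ} (e : Exponents) (a : E d × E d → ℝ) (v : E d → ℝ) : ℝ≥0∞ :=
  phase e.s e.p (fun _ => 1) v + phase e.t e.q a v

/-- `W_0(Ω)`: locally integrable functions on `ℝ^d` of finite energy, zero outside `Ω`. -/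
def W0 {d : ℕ} (e : Exponents) (a : E d × E d → ℝ) (Ω : Set (E d)) : Set (E d → ℝ) :=
  {v | LocallyIntegrable v volume ∧ energy e a v < ⊤ ∧ ∀ᵐ x ∂volume, x ∉ Ω → v x = 0}

/-- `W_{u_D}(Ω) = u_D + W_0(Ω)`. -/
def W {d : ℕ} (e : Exponents) (a : E d × E d → ℝ) (Ω : Set (E d)) (uD : E d → ℝ) :
    Set (E d → ℝ) :=
  {v | v - uD ∈ W0 e a Ω}

/-- The Luxemburg norm `inf {l > 0 : J(v / l) ≤ 1}` (equal to `∞` if there is no such `l`). -/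
def luxNorm {d : ℕ} (e : Exponents) (a : E d × E d → ℝ) (v : E d → ℝ) : ℝ≥0∞ :=
  ⨅ (l : ℝ) (_ : 0 < l) (_ : energy e a (fun x => v x / l) ≤ 1), ENNReal.ofReal l

/-- `C_0^∞(Ω)`: smooth functions on `ℝ^d` with compact support contained in `Ω`. -/
def testFunctions {d : ℕ} (Ω : Set (E d)) : Set (E d → ℝ) :=
  {φ | ContDiff ℝ ∞ φ ∧ HasCompactSupport φ ∧ tsupport φ ⊆ Ω}

/-- `H_0(Ω)`: the closure of `C_0^∞(Ω)` in `W_0(Ω)` with respect to the Luxemburg norm. -/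
def H0 {d : ℕ} (e : Exponents) (a : E d × E d → ℝ) (Ω : Set (E d)) : Set (E d → ℝ) :=
  {v | v ∈ W0 e a Ω ∧ ∀ ε : ℝ≥0∞, 0 < ε → ∃ φ ∈ testFunctions Ω, luxNorm e a (v - φ) < ε}

/-- `H_{u_D}(Ω) = u_D + H_0(Ω)`. -/
def H {d : ℕ} (e : Exponents) (a : E d × E d → ℝ) (Ω : Set (E d)) (uD : E d → ℝ) :
    Set (E d → ℝ) :=
  {v | v - uD ∈ H0 e a Ω}

/-- The Lavrentiev gap on `Ω = (-1,1)^d`: for some boundary datum `u_D`, smooth on `ℝ^d` and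
zero outside `3Ω` (so bounded), the infimum of the energy over `W_{u_D}(Ω)` is strictly below
the one over `H_{u_D}(Ω)`. -/
def LavrentievGap {d : ℕ} (e : Exponents) (a : E d × E d → ℝ) : Prop :=
  ∃ uD : E d → ℝ, ContDiff ℝ ∞ uD ∧ (∀ x, x ∉ cube d 3 → uD x = 0) ∧
    (⨅ v ∈ W e a (cube d 1) uD, energy e a v) < (⨅ v ∈ H e a (cube d 1) uD, energy e a v)

/-- `C^α(ℝ^d × ℝ^d)` with bounded norm, that is `C^{k, α - k}` with `k = ⌊α⌋`: `k` times
continuously differentiable, all derivatives of order at most `k` bounded on the whole space, and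
the derivative of order `k` globally Hölder continuous with exponent `α - k`. -/
def HolderClass {d : ℕ} (α : ℝ) (a : E d × E d → ℝ) : Prop :=
  ContDiff ℝ ⌊α⌋₊ a ∧
  (∀ m : ℕ, m ≤ ⌊α⌋₊ → ∃ C : ℝ, ∀ z, ‖iteratedFDeriv ℝ m a z‖ ≤ C) ∧
  ∃ C : ℝ, ∀ z z', ‖iteratedFDeriv ℝ ⌊α⌋₊ a z - iteratedFDeriv ℝ ⌊α⌋₊ a z'‖ ≤
    C * ‖z - z'‖ ^ (α - ⌊α⌋₊)

end DoublePhase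

end

/-!
The gap comes from a Cantor set `S` in the unit cube, with `m ^ d` pieces of contraction ratio
`1 / R`, whose codimension `d - d log m / log R` lies strictly between `s p` and `t q - α`
(`exists_parameters`). To every piece of generation `n` two disjoint balls of radius comparable to
`R ^ (-n)` are attached, one of each of two families; the balls of generation zero lie outside the
unit cube, all others inside (`site`, `site_families_disjoint`). The weight couples, within each
family, the balls of generation `n` to those of generation `n + 1`, with strength `R ^ (-α' n)` for
some `α'` slightly larger than `α`; the two families are not coupled to each other. Since
separated balls are coupled directly, the construction works in every dimension, also for `d = 1`.

The competitor is `1` on the first family and `0` on the second. Its second phase vanishes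
(`phase_weight_competitor`). Its first phase is finite (`phase_competitor_lt_top`), because it is
the supremum of at most `m ^ (d n)` bumps of scale `R ^ (-n)` for each `n`, and the codimension of
`S` is larger than `s p`.

A continuous function `v` with the same boundary values cannot do this
(`exists_le_phase_weight`). There is a branch of the tree of pieces along which the energy decays as
fast as the number of pieces grows (`exists_branch`). As the codimension of `S` is smaller than
`t q - α'`, small energy makes the total variation of the values of `v` along the branch small, in
either family (`half_measure_le_of_chain`). So `v` stays close to `1` on the balls of the first
family and close to `0` on those of the second one, while both shrink to the same point. This gives
a positive lower bound for the second phase on `u_D + C_0^∞(Ω)`, which passes to the closure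
(`le_phase_of_mem_H`). A large constant factor in front of the weight raises this bound above the
energy of the competitor, which does not change.

The weight is a lacunary series, of class `C^α` for all `α < α'` (`holderClass_tsum`): at each
generation the bumps have disjoint supports, so that the derivatives of their sum obey the bounds of
a single bump (`exists_scaledBounds_layer`).
-/

noncomputable section

namespace DoublePhase

/-! ### Energies: triangle inequality, suprema, scaling and finiteness -/

/-- The integrand of `phase`, the density of the nonlocal energy of `v` at the pair `(x, y)`. -/
def phaseDensity {d : ℕ} (σ r : ℝ) (w : E d × E d → ℝ) (v : E d → ℝ) (z : E d × E d) : ℝ≥0∞ :=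
  ENNReal.ofReal
    (1 / r * w z * |v z.1 - v z.2| ^ r / ‖z.1 - z.2‖ ^ ((d : ℝ) + σ * r))

lemma phase_eq_lintegral_phaseDensity {d : ℕ} (σ r : ℝ) (w : E d × E d → ℝ) (v : E d → ℝ) :
    phase σ r w v = ∫⁻ x, ∫⁻ y, phaseDensity σ r w v (x, y) := rfl

lemma measurable_phaseDensity {d : ℕ} {σ r : ℝ} {w : E d × E d → ℝ} {v : E d → ℝ}
    (hw : Measurable w) (hv : Measurable v) : Measurable (phaseDensity σ r w v) := by
  unfold phaseDensity
  refine ENNReal.measurable_ofReal.comp ?_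
  have h1 : Measurable fun z : E d × E d => |v z.1 - v z.2| ^ r :=
    ((hv.comp measurable_fst).sub (hv.comp measurable_snd)).abs.pow_const r
  have h2 : Measurable fun z : E d × E d => ‖z.1 - z.2‖ ^ ((d : ℝ) + σ * r) :=
    (measurable_fst.sub measurable_snd).norm.pow_const _
  exact ((hw.const_mul _).mul h1).div h2

lemma phase_congr_ae {d : ℕ} {σ r : ℝ} {w : E d × E d → ℝ} {v v' : E d → ℝ}
    (h : v =ᵐ[volume] v') : phase σ r w v = phase σ r w v' := by
  unfold phase
  refine lintegral_congr_ae ?_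
  filter_upwards [h] with x hx
  refine lintegral_congr_ae ?_
  filter_upwards [h] with y hy
  rw [hx, hy]

lemma phaseDensity_add_le {d : ℕ} {σ r : ℝ} (hr : 0 < r) {w : E d × E d → ℝ} (hw : ∀ z, 0 ≤ w z)
    (f g : E d → ℝ) (z : E d × E d) :
    phaseDensity σ r w (f + g) z ≤
      ENNReal.ofReal (2 ^ r) * (phaseDensity σ r w f z + phaseDensity σ r w g z) := by
  unfold phaseDensity
  have hD : 0 ≤ ‖z.1 - z.2‖ ^ ((d : ℝ) + σ * r) := by positivity
  have hwz := hw z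
  rw [← ENNReal.ofReal_add (by positivity) (by positivity), ← ENNReal.ofReal_mul (by positivity)]
  refine ENNReal.ofReal_le_ofReal ?_
  rw [← add_div, mul_div_assoc', ← mul_add, mul_left_comm]
  refine div_le_div_of_nonneg_right (mul_le_mul_of_nonneg_left ?_ (by positivity)) hD
  set a := |f z.1 - f z.2|
  set b := |g z.1 - g z.2|
  have ha : 0 ≤ a := abs_nonneg _
  have hb : 0 ≤ b := abs_nonneg _
  have h1 : |(f + g) z.1 - (f + g) z.2| ≤ 2 * max a b := by
    have : (f + g) z.1 - (f + g) z.2 = (f z.1 - f z.2) + (g z.1 - g z.2) := by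
      simp only [Pi.add_apply]; ring
    rw [this]
    have := abs_add_le (f z.1 - f z.2) (g z.1 - g z.2)
    have := le_max_left a b
    have := le_max_right a b
    linarith
  have hm : 0 ≤ max a b := le_max_of_le_left ha
  calc |(f + g) z.1 - (f + g) z.2| ^ r ≤ (2 * max a b) ^ r :=
        Real.rpow_le_rpow (abs_nonneg _) h1 hr.le
    _ = 2 ^ r * max a b ^ r := Real.mul_rpow (by norm_num) hm
    _ ≤ 2 ^ r * (a ^ r + b ^ r) := by
        refine mul_le_mul_of_nonneg_left ?_ (by positivity)
        have := Real.rpow_nonneg ha r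
        have := Real.rpow_nonneg hb r
        rcases max_choice a b with h | h <;> rw [h] <;> linarith

lemma phase_add_le {d : ℕ} {σ r : ℝ} (hr : 0 < r) {w : E d × E d → ℝ} (hw : ∀ z, 0 ≤ w z)
    (hwm : Measurable w) {f g : E d → ℝ} (hf : AEStronglyMeasurable f volume) :
    phase σ r w (f + g) ≤ ENNReal.ofReal (2 ^ r) * (phase σ r w f + phase σ r w g) := by
  set f' := hf.mk f
  have hf' : Measurable f' := hf.stronglyMeasurable_mk.measurable
  have hff' : f =ᵐ[volume] f' := hf.ae_eq_mk
  rw [phase_congr_ae hff', phase_congr_ae (hff'.add (Filter.EventuallyEq.refl _ g))]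
  simp only [phase_eq_lintegral_phaseDensity]
  have hm := measurable_phaseDensity (σ := σ) (r := r) hwm hf'
  calc _ ≤ ∫⁻ x, ∫⁻ y, ENNReal.ofReal (2 ^ r) *
          (phaseDensity σ r w f' (x, y) + phaseDensity σ r w g (x, y)) :=
        lintegral_mono fun x => lintegral_mono fun y => phaseDensity_add_le hr hw f' g (x, y)
    _ = _ := by
        simp_rw [lintegral_const_mul' _ _ ENNReal.ofReal_ne_top]
        congr 1
        rw [← lintegral_add_left hm.lintegral_prod_right']
        refine lintegral_congr fun x => ?_
        exact lintegral_add_left (hm.comp measurable_prodMk_left) _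

lemma phase_const_mul_weight {d : ℕ} {σ r : ℝ} {w : E d × E d → ℝ} {f : E d → ℝ} {l : ℝ}
    (hl : 0 ≤ l) : phase σ r (fun z => l * w z) f = ENNReal.ofReal l * phase σ r w f := by
  unfold phase
  simp_rw [← lintegral_const_mul' _ _ ENNReal.ofReal_ne_top, ← ENNReal.ofReal_mul hl]
  refine lintegral_congr fun x => lintegral_congr fun y => ?_
  congr 1
  ring

lemma phase_eq_rpow_mul_phase_div {d : ℕ} {σ r : ℝ} {w : E d × E d → ℝ} {f : E d → ℝ} {l : ℝ}
    (hl : 0 < l) :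
    phase σ r w f = ENNReal.ofReal (l ^ r) * phase σ r w (fun x => f x / l) := by
  unfold phase
  have hlr : 0 < l ^ r := Real.rpow_pos_of_pos hl r
  simp_rw [← lintegral_const_mul' _ _ ENNReal.ofReal_ne_top, ← ENNReal.ofReal_mul hlr.le]
  refine lintegral_congr fun x => lintegral_congr fun y => ?_
  congr 1
  rw [← sub_div, abs_div, abs_of_pos hl, Real.div_rpow (abs_nonneg _) hl.le]
  field_simp

/-- The energy of a supremum is at most the sum of the energies, since increments of a supremum
are controlled by the largest increment. -/
lemma phase_iSup_le_tsum {d : ℕ} {σ r : ℝ} (hr : 0 < r) {w : E d × E d → ℝ} (hw : ∀ z, 0 ≤ w z)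
    (hwm : Measurable w) {ι : Type*} [Countable ι] [Nonempty ι] {f : ι → E d → ℝ}
    (hfm : ∀ i, Measurable (f i)) (hf1 : ∀ i x, f i x ≤ 1) :
    phase σ r w (fun x => ⨆ i, f i x) ≤ ∑' i, phase σ r w (f i) := by
  have hbdd : ∀ x, BddAbove (Set.range fun i => f i x) := fun x =>
    ⟨1, by rintro _ ⟨i, rfl⟩; exact hf1 i x⟩
  have key : ∀ z, phaseDensity σ r w (fun x => ⨆ i, f i x) z ≤
      ∑' i, phaseDensity σ r w (f i) z := by
    intro z
    set T := ∑' i, phaseDensity σ r w (f i) z with hT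
    rcases eq_or_ne T ⊤ with h | h
    · rw [h]; exact le_top
    set D := ‖z.1 - z.2‖ ^ ((d : ℝ) + σ * r)
    have hD : 0 ≤ D := by positivity
    have hwz := hw z
    set c := 1 / r * w z / D
    have hc : 0 ≤ c := by positivity
    have hdens : ∀ v : E d → ℝ, phaseDensity σ r w v z =
        ENNReal.ofReal (c * |v z.1 - v z.2| ^ r) := by
      intro v; unfold phaseDensity; congr 1; simp only [c, D]; ring
    rcases hc.eq_or_lt with h0 | h0
    · rw [hdens, ← h0]; simp
    have hi : ∀ i, |f i z.1 - f i z.2| ≤ (T.toReal / c) ^ r⁻¹ := by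
      intro i
      have h1 : ENNReal.ofReal (c * |f i z.1 - f i z.2| ^ r) ≤ T := by
        rw [← hdens]; exact ENNReal.le_tsum i
      rw [ENNReal.ofReal_le_iff_le_toReal h] at h1
      rw [Real.le_rpow_inv_iff_of_pos (abs_nonneg _) (by positivity) hr, le_div_iff₀' h0]
      exact h1
    have hsup : |(⨆ i, f i z.1) - ⨆ i, f i z.2| ≤ (T.toReal / c) ^ r⁻¹ := by
      rw [abs_sub_le_iff]
      constructor
      · rw [sub_le_iff_le_add]
        refine ciSup_le fun i => ?_
        have := le_ciSup (hbdd z.2) i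
        have := (abs_sub_le_iff.1 (hi i)).1
        linarith
      · rw [sub_le_iff_le_add]
        refine ciSup_le fun i => ?_
        have := le_ciSup (hbdd z.1) i
        have := (abs_sub_le_iff.1 (hi i)).2
        linarith
    rw [hdens, ENNReal.ofReal_le_iff_le_toReal h, ← le_div_iff₀' h0,
      ← Real.le_rpow_inv_iff_of_pos (abs_nonneg _) (by positivity) hr]
    exact hsup
  simp only [phase_eq_lintegral_phaseDensity]
  have hm := fun i => measurable_phaseDensity (σ := σ) (r := r) hwm (hfm i)
  rw [← lintegral_tsum fun i => (hm i).lintegral_prod_right'.aemeasurable]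
  refine lintegral_mono fun x => ?_
  rw [← lintegral_tsum (f := fun i y => phaseDensity σ r w (f i) (x, y))
    fun i => ((hm i).comp measurable_prodMk_left).aemeasurable]
  exact lintegral_mono fun y => key (x, y)

lemma lintegral_comp_smul_sub {d : ℕ} {c : ℝ} (hc : 0 < c) (u : E d) (F : E d → ℝ≥0∞) :
    ∫⁻ x, F (c • x - u) = ENNReal.ofReal ((c ^ d)⁻¹) * ∫⁻ x, F x := by
  have h1 : ∫⁻ x, F (c • x - u) =
      ∫⁻ x, F (x - u) ∂(Measure.map (fun x : E d => c • x) volume) :=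
    ((Homeomorph.smulOfNeZero (α := E d) c hc.ne').measurableEmbedding.lintegral_map
      (fun x => F (x - u))).symm
  rw [h1, Measure.map_addHaar_smul _ hc.ne', lintegral_smul_measure,
    lintegral_sub_right_eq_self (fun x => F x)]
  simp [abs_of_pos (pow_pos hc d)]

lemma phase_comp_smul_sub {d : ℕ} {σ r : ℝ} {c : ℝ} (hc : 0 < c) (u : E d) (f : E d → ℝ) :
    phase σ r (fun _ => 1) (fun x => f (c • x - u)) =
      ENNReal.ofReal (c ^ (σ * r - d)) * phase σ r (fun _ => 1) f := by
  simp only [phase_eq_lintegral_phaseDensity]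
  have key : ∀ x y : E d, phaseDensity σ r (fun _ => 1) (fun x => f (c • x - u)) (x, y) =
      ENNReal.ofReal (c ^ (d + σ * r)) *
        phaseDensity σ r (fun _ => 1) f (c • x - u, c • y - u) := by
    intro x y
    unfold phaseDensity
    rw [← ENNReal.ofReal_mul (by positivity)]
    congr 1
    have : ‖(c • x - u) - (c • y - u)‖ = c * ‖x - y‖ := by
      rw [sub_sub_sub_cancel_right, ← smul_sub, norm_smul, Real.norm_eq_abs, abs_of_pos hc]
    simp only [this]
    rw [Real.mul_rpow hc.le (norm_nonneg _)]
    have := (Real.rpow_pos_of_pos hc (d + σ * r)).ne'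
    field_simp
  simp_rw [key, lintegral_const_mul' _ _ ENNReal.ofReal_ne_top]
  simp_rw [fun x' => lintegral_comp_smul_sub hc u (fun y => phaseDensity σ r (fun _ => 1) f (x', y))]
  rw [lintegral_comp_smul_sub hc u (fun x' => ENNReal.ofReal ((c ^ d)⁻¹) *
    ∫⁻ y, phaseDensity σ r (fun _ => 1) f (x', y)),
    lintegral_const_mul' _ _ ENNReal.ofReal_ne_top]
  rw [← mul_assoc, ← mul_assoc, ← ENNReal.ofReal_mul (by positivity),
    ← ENNReal.ofReal_mul (by positivity)]
  congr 2
  rw [Real.rpow_sub hc, Real.rpow_add hc, Real.rpow_natCast]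
  have := (pow_pos hc d).ne'
  field_simp

/-- Integrability of the kernel `min (L |h|) 1 ^ r / |h| ^ (d + σ r)`: the exponent of `|h|` is
above `-d` at the origin because `σ < 1`, and below `-d` at infinity because `σ > 0`. -/
lemma lintegral_min_kernel_lt_top {d : ℕ} (hd : d ≠ 0) {σ r L : ℝ} (hσ : 0 < σ) (hσ1 : σ < 1)
    (hr : 0 < r) (hL : 0 ≤ L) :
    ∫⁻ h : E d, ENNReal.ofReal (min (L * ‖h‖) 1 ^ r / ‖h‖ ^ ((d : ℝ) + σ * r)) < ⊤ := by
  have : Nonempty (Fin d) := ⟨⟨0, Nat.pos_of_ne_zero hd⟩⟩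
  have : Nontrivial (E d) := inferInstance
  set F : ℝ → ℝ := fun y => min (L * y) 1 ^ r / y ^ ((d : ℝ) + σ * r)
  have hFm : Measurable F :=
    (((measurable_id.const_mul L).min measurable_const).pow_const r).div
      (measurable_id.pow_const _)
  have hint : Integrable (fun h : E d => F ‖h‖) volume := by
    rw [integrable_fun_norm_addHaar volume (f := F), ← Set.Ioc_union_Ioi_eq_Ioi zero_le_one]
    have hm : ∀ s : Set ℝ, AEStronglyMeasurable
        (fun y : ℝ => y ^ (Module.finrank ℝ (E d) - 1) • F y) (volume.restrict s) := fun s =>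
      ((measurable_id.pow_const _).smul hFm).aestronglyMeasurable
    have hpow : ∀ y : ℝ, 0 < y → y ^ (Module.finrank ℝ (E d) - 1) = y ^ ((d : ℝ) - 1) := by
      intro y hy
      rw [finrank_euclideanSpace, Fintype.card_fin, ← Real.rpow_natCast]
      congr 1
      rw [Nat.cast_sub (Nat.pos_of_ne_zero hd)]; simp
    refine IntegrableOn.union ?_ ?_
    · have h1 : IntegrableOn (fun y : ℝ => L ^ r * y ^ ((1 - σ) * r - 1)) (Set.Ioc 0 1) := by
        have : 0 < (1 - σ) * r := mul_pos (by linarith) hr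
        exact ((intervalIntegral.intervalIntegrable_rpow' (by linarith)).1).const_mul _
      refine Integrable.mono' h1 (hm _) ?_
      filter_upwards [ae_restrict_mem measurableSet_Ioc] with y hy
      have hy0 : 0 < y := hy.1
      have hmin : 0 ≤ min (L * y) 1 := le_min (by positivity) zero_le_one
      rw [hpow y hy0, smul_eq_mul, Real.norm_of_nonneg (by positivity)]
      calc y ^ ((d : ℝ) - 1) * F y
          ≤ y ^ ((d : ℝ) - 1) * ((L * y) ^ r / y ^ ((d : ℝ) + σ * r)) := by
            refine mul_le_mul_of_nonneg_left ?_ (by positivity)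
            refine div_le_div_of_nonneg_right ?_ (by positivity)
            exact Real.rpow_le_rpow hmin (min_le_left _ _) hr.le
        _ = L ^ r * y ^ ((1 - σ) * r - 1) := by
            rw [Real.mul_rpow hL hy0.le, mul_div_assoc, ← Real.rpow_sub hy0, mul_left_comm,
              ← Real.rpow_add hy0]
            ring_nf
    · have h1 : IntegrableOn (fun y : ℝ => y ^ (-1 - σ * r)) (Set.Ioi 1) := by
        have : 0 < σ * r := mul_pos hσ hr
        exact integrableOn_Ioi_rpow_of_lt (by linarith) one_pos
      refine Integrable.mono' h1 (hm _) ?_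
      filter_upwards [ae_restrict_mem measurableSet_Ioi] with y hy
      have hy0 : 0 < y := lt_trans one_pos hy
      have hmin : 0 ≤ min (L * y) 1 := le_min (by positivity) zero_le_one
      rw [hpow y hy0, smul_eq_mul, Real.norm_of_nonneg (by positivity)]
      calc y ^ ((d : ℝ) - 1) * F y
          ≤ y ^ ((d : ℝ) - 1) * (1 / y ^ ((d : ℝ) + σ * r)) := by
            refine mul_le_mul_of_nonneg_left ?_ (by positivity)
            refine div_le_div_of_nonneg_right ?_ (by positivity)
            exact Real.rpow_le_one hmin (min_le_right _ _) hr.le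
        _ = y ^ (-1 - σ * r) := by
            rw [one_div, ← Real.rpow_neg hy0.le, ← Real.rpow_add hy0]
            ring_nf
  exact hint.lintegral_lt_top

/-- A Lipschitz function with values in `[0, 1]` and bounded support has finite energy. -/
lemma phase_lt_top_of_lipschitz {d : ℕ} (hd : d ≠ 0) {σ r L M : ℝ} (hσ : 0 < σ) (hσ1 : σ < 1)
    (hr : 0 < r) (hL : 0 ≤ L) {w : E d × E d → ℝ} (hw : ∀ z, 0 ≤ w z) (hwM : ∀ z, w z ≤ M)
    {f : E d → ℝ} (h0 : ∀ x, 0 ≤ f x) (h1 : ∀ x, f x ≤ 1)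
    (hf : ∀ x y, |f x - f y| ≤ L * ‖x - y‖) {B : Set (E d)} (hB : MeasurableSet B)
    (hBvol : volume B ≠ ⊤) (hsupp : ∀ x, x ∉ B → f x = 0) :
    phase σ r w f < ⊤ := by
  have hM : 0 ≤ M := (hw 0).trans (hwM 0)
  set k : E d → ℝ≥0∞ := fun h =>
    ENNReal.ofReal (min (L * ‖h‖) 1 ^ r / ‖h‖ ^ ((d : ℝ) + σ * r)) with hk
  have hkm : Measurable k := by
    refine ENNReal.measurable_ofReal.comp ?_
    exact (((measurable_norm.const_mul L).min measurable_const).pow_const r).div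
      (measurable_norm.pow_const _)
  have hkfin : ∫⁻ h, k h < ⊤ := lintegral_min_kernel_lt_top hd hσ hσ1 hr hL
  have hpt : ∀ x y, phaseDensity σ r w f (x, y) ≤
      ENNReal.ofReal (1 / r * M) * (B.indicator (fun _ => k (x - y)) x +
        B.indicator (fun _ => k (x - y)) y) := by
    intro x y
    have hle : phaseDensity σ r w f (x, y) ≤ ENNReal.ofReal (1 / r * M) * k (x - y) := by
      rw [hk, ← ENNReal.ofReal_mul (by positivity)]
      refine ENNReal.ofReal_le_ofReal ?_
      rw [← mul_div_assoc]
      refine div_le_div_of_nonneg_right ?_ (by positivity)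
      refine mul_le_mul (mul_le_mul_of_nonneg_left (hwM _) (by positivity)) ?_ (by positivity)
        (by positivity)
      refine Real.rpow_le_rpow (abs_nonneg _) (le_min (hf x y) ?_) hr.le
      rw [abs_sub_le_iff]
      constructor <;> linarith [h0 x, h1 x, h0 y, h1 y]
    by_cases hx : x ∈ B
    · rw [Set.indicator_of_mem hx]
      exact hle.trans (mul_le_mul_right le_self_add _)
    by_cases hy : y ∈ B
    · rw [Set.indicator_of_mem hy]
      exact hle.trans (mul_le_mul_right le_add_self _)
    · have : phaseDensity σ r w f (x, y) = 0 := by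
        simp [phaseDensity, hsupp x hx, hsupp y hy, Real.zero_rpow hr.ne']
      rw [this]; exact zero_le
  have hkx : ∀ x, ∫⁻ y, k (x - y) = ∫⁻ h, k h := fun x => lintegral_sub_left_eq_self k x
  have hky : ∀ y, ∫⁻ x, k (x - y) = ∫⁻ h, k h := fun y => lintegral_sub_right_eq_self k y
  have hkm2 : Measurable fun z : E d × E d => k (z.1 - z.2) :=
    hkm.comp (measurable_fst.sub measurable_snd)
  have hm1 : Measurable fun z : E d × E d => B.indicator (fun _ => k (z.1 - z.2)) z.1 := by
    have := hkm2.indicator (measurable_fst hB)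
    exact this
  have hm2 : Measurable fun z : E d × E d => B.indicator (fun _ => k (z.1 - z.2)) z.2 := by
    have := hkm2.indicator (measurable_snd hB)
    exact this
  have e1 : ∫⁻ x, ∫⁻ y, B.indicator (fun _ => k (x - y)) x = volume B * ∫⁻ h, k h := by
    have : ∀ x, ∫⁻ y, B.indicator (fun _ => k (x - y)) x =
        B.indicator (fun _ => ∫⁻ h, k h) x := by
      intro x
      by_cases hx : x ∈ B
      · simp only [Set.indicator_of_mem hx, hkx]
      · simp [Set.indicator_of_notMem hx]
    simp_rw [this]
    rw [lintegral_indicator hB, setLIntegral_const, mul_comm]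
  have e2 : ∫⁻ x, ∫⁻ y, B.indicator (fun _ => k (x - y)) y = volume B * ∫⁻ h, k h := by
    rw [lintegral_lintegral_swap hm2.aemeasurable]
    have : ∀ y, ∫⁻ x, B.indicator (fun _ => k (x - y)) y =
        B.indicator (fun _ => ∫⁻ h, k h) y := by
      intro y
      by_cases hy : y ∈ B
      · simp only [Set.indicator_of_mem hy, hky]
      · simp [Set.indicator_of_notMem hy]
    simp_rw [this]
    rw [lintegral_indicator hB, setLIntegral_const, mul_comm]
  rw [phase_eq_lintegral_phaseDensity]
  calc ∫⁻ x, ∫⁻ y, phaseDensity σ r w f (x, y)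
      ≤ ∫⁻ x, ∫⁻ y, ENNReal.ofReal (1 / r * M) * (B.indicator (fun _ => k (x - y)) x +
        B.indicator (fun _ => k (x - y)) y) :=
        lintegral_mono fun x => lintegral_mono fun y => hpt x y
    _ = ENNReal.ofReal (1 / r * M) * (volume B * (∫⁻ h, k h) + volume B * ∫⁻ h, k h) := by
        simp_rw [lintegral_const_mul' _ _ ENNReal.ofReal_ne_top]
        rw [← e1]
        nth_rewrite 2 [e1]
        rw [← e2, ← lintegral_add_left hm1.lintegral_prod_right']
        congr 1
        refine lintegral_congr fun x => ?_
        exact lintegral_add_left (hm1.comp measurable_prodMk_left) _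
    _ < ⊤ := by
        have : volume B * ∫⁻ h, k h < ⊤ := ENNReal.mul_lt_top hBvol.lt_top hkfin
        exact ENNReal.mul_lt_top ENNReal.ofReal_lt_top (ENNReal.add_lt_top.2 ⟨this, this⟩)

/-! ### A Cantor set and two families of balls around it -/

/-- The natural numbers with at most `n` digits in base `R`, all of them below `m`. -/
def digits (R m : ℕ) : ℕ → Finset ℕ
  | 0 => {0}
  | n + 1 => Finset.image₂ (fun a j => R * a + j) (digits R m n) (Finset.range m)

lemma mem_digits_succ {R m n a : ℕ} :
    a ∈ digits R m (n + 1) ↔ ∃ b ∈ digits R m n, ∃ j < m, R * b + j = a := by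
  simp [digits, Finset.mem_image₂]

lemma card_digits_le (R m n : ℕ) : (digits R m n).card ≤ m ^ n := by
  induction n with
  | zero => simp [digits]
  | succ n ih =>
    calc (digits R m (n + 1)).card ≤ (digits R m n).card * (Finset.range m).card :=
          Finset.card_image₂_le _ _ _
      _ ≤ m ^ n * m := by rw [Finset.card_range]; exact Nat.mul_le_mul_right _ ih
      _ = m ^ (n + 1) := (pow_succ _ _).symm

lemma digits_lt {R m : ℕ} (hR : 16 * m + 1 ≤ R) {n a : ℕ} (ha : a ∈ digits R m n) :
    16 * a + 1 ≤ R ^ n := by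
  induction n generalizing a with
  | zero => simp_all [digits]
  | succ n ih =>
    obtain ⟨b, hb, j, hj, rfl⟩ := mem_digits_succ.1 ha
    have := Nat.mul_le_mul_left R (ih hb)
    rw [pow_succ']
    nlinarith

/-- Truncation of the last `k` digits leaves a remainder of size below `R ^ k / 16`. -/
lemma exists_eq_pow_mul_add_of_mem_digits {R m : ℕ} (hR : 16 * m + 1 ≤ R) {n k a : ℕ}
    (hk : k ≤ n) (ha : a ∈ digits R m n) :
    ∃ a₀ b, a = R ^ k * a₀ + b ∧ 16 * b + 1 ≤ R ^ k := by
  induction k generalizing n a with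
  | zero => exact ⟨a, 0, by simp, by simp⟩
  | succ k ih =>
    obtain ⟨n, rfl⟩ : ∃ n', n = n' + 1 := ⟨n - 1, by omega⟩
    obtain ⟨a', ha', j, hj, rfl⟩ := mem_digits_succ.1 ha
    obtain ⟨a₀, b, rfl, hb⟩ := ih (by omega) ha'
    refine ⟨a₀, R * b + j, by ring, ?_⟩
    have := Nat.mul_le_mul_left R hb
    rw [pow_succ']
    nlinarith

/-- At every pair of scales, the intervals to the right of the points of one digit set stay away
from the intervals to the left of the points of the other one. -/
lemma digits_right_left_separated {R m : ℕ} (hR : 16 * m + 1 ≤ R) {n k a a' : ℕ}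
    (ha : a ∈ digits R m n) (ha' : a' ∈ digits R m k) {X : ℝ}
    (h1 : |(R : ℝ) ^ n * X - (8 * a + 2)| ≤ 1 / 2)
    (h2 : |(R : ℝ) ^ k * X - (8 * a' - 2)| ≤ 1 / 2) : False := by
  have hR1 : (1 : ℝ) ≤ R := by exact_mod_cast (by omega : 1 ≤ R)
  rw [abs_le] at h1 h2
  rcases le_total n k with hnk | hnk
  · obtain ⟨l, rfl⟩ := Nat.exists_eq_add_of_le hnk
    obtain ⟨a₀, b, rfl, hb⟩ := exists_eq_pow_mul_add_of_mem_digits hR (Nat.le_add_left l n) ha'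
    have hP1 : (1 : ℝ) ≤ (R : ℝ) ^ l := one_le_pow₀ hR1
    have hb' : 16 * (b : ℝ) + 1 ≤ (R : ℝ) ^ l := by exact_mod_cast hb
    have hb0 : (0 : ℝ) ≤ b := Nat.cast_nonneg b
    rw [pow_add] at h2
    push_cast at h2
    set P := (R : ℝ) ^ l
    set Y := (R : ℝ) ^ n * X
    have e : (R : ℝ) ^ n * P * X = P * Y := by simp only [Y]; ring
    rw [e] at h2
    have l1 := mul_le_mul_of_nonneg_left h1.1 (by linarith : (0 : ℝ) ≤ P)
    have l2 := mul_le_mul_of_nonneg_left h1.2 (by linarith : (0 : ℝ) ≤ P)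
    rcases le_or_gt a₀ a with h | h
    · have h' : (a₀ : ℝ) ≤ a := by exact_mod_cast h
      have := mul_le_mul_of_nonneg_left h' (by linarith : (0 : ℝ) ≤ P)
      linarith
    · have h' : (a : ℝ) + 1 ≤ a₀ := by exact_mod_cast h
      have := mul_le_mul_of_nonneg_left h' (by linarith : (0 : ℝ) ≤ P)
      linarith
  · obtain ⟨l, rfl⟩ := Nat.exists_eq_add_of_le hnk
    obtain ⟨a₀, b, rfl, hb⟩ := exists_eq_pow_mul_add_of_mem_digits hR (Nat.le_add_left l k) ha
    have hP1 : (1 : ℝ) ≤ (R : ℝ) ^ l := one_le_pow₀ hR1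
    have hb' : 16 * (b : ℝ) + 1 ≤ (R : ℝ) ^ l := by exact_mod_cast hb
    have hb0 : (0 : ℝ) ≤ b := Nat.cast_nonneg b
    rw [pow_add] at h1
    push_cast at h1
    set P := (R : ℝ) ^ l
    set Y := (R : ℝ) ^ k * X
    have e : (R : ℝ) ^ k * P * X = P * Y := by simp only [Y]; ring
    rw [e] at h1
    have l1 := mul_le_mul_of_nonneg_left h2.1 (by linarith : (0 : ℝ) ≤ P)
    have l2 := mul_le_mul_of_nonneg_left h2.2 (by linarith : (0 : ℝ) ≤ P)
    rcases le_or_gt a' a₀ with h | h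
    · have h' : (a' : ℝ) ≤ a₀ := by exact_mod_cast h
      have := mul_le_mul_of_nonneg_left h' (by linarith : (0 : ℝ) ≤ P)
      linarith
    · have h' : (a₀ : ℝ) + 1 ≤ a' := by exact_mod_cast h
      have := mul_le_mul_of_nonneg_left h' (by linarith : (0 : ℝ) ≤ P)
      linarith

/-- The lattice points of generation `n`: every coordinate has `n` digits in base `R`, all of them
below `m`. The points `8 t / R ^ n`, for `t` in this set, are the generation `n` approximation of
a self-similar Cantor set with `m ^ d` pieces of contraction ratio `1 / R`. -/
def nodes (d R m n : ℕ) : Finset (Fin d → ℕ) := Fintype.piFinset fun _ => digits R m n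

lemma mem_nodes {d R m n : ℕ} {t : Fin d → ℕ} : t ∈ nodes d R m n ↔ ∀ i, t i ∈ digits R m n :=
  Fintype.mem_piFinset

lemma zero_mem_nodes_zero {d R m : ℕ} : (0 : Fin d → ℕ) ∈ nodes d R m 0 := by
  simp [mem_nodes, digits]

lemma child_mem_nodes {d R m n : ℕ} {t : Fin d → ℕ} (ht : t ∈ nodes d R m n)
    (j : Fin d → Fin m) : (fun i => R * t i + j i) ∈ nodes d R m (n + 1) :=
  mem_nodes.2 fun i => mem_digits_succ.2 ⟨t i, mem_nodes.1 ht i, j i, (j i).2, rfl⟩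

lemma card_nodes_le (d R m n : ℕ) : (nodes d R m n).card ≤ (m ^ d) ^ n := by
  rw [nodes, Fintype.card_piFinset_const]
  calc (digits R m n).card ^ d ≤ (m ^ n) ^ d := Nat.pow_le_pow_left (card_digits_le R m n) d
    _ = (m ^ d) ^ n := by rw [← pow_mul, ← pow_mul, mul_comm]

/-- In coordinates rescaled by `R ^ n`, the centre of the ball attached to the node `t` of
generation `n`: the node itself, shifted by `κ` in the direction `i₀`. The shift `κ = 2` gives one
family of balls and the shift `κ = -2` the other one. -/
def site {d : ℕ} (i₀ : Fin d) (κ : ℝ) (t : Fin d → ℕ) : E d :=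
  WithLp.toLp 2 (fun i => (8 : ℝ) * t i) + EuclideanSpace.single i₀ κ

lemma site_apply {d : ℕ} (i₀ : Fin d) (κ : ℝ) (t : Fin d → ℕ) (i : Fin d) :
    site i₀ κ t i = 8 * t i + if i = i₀ then κ else 0 := by
  simp [site]

lemma abs_coord_le_norm {d : ℕ} (x : E d) (i : Fin d) : |x i| ≤ ‖x‖ := by
  simpa using PiLp.norm_apply_le x i

lemma abs_coord_sub_site_le {d : ℕ} {i₀ : Fin d} {κ c r : ℝ} {t : Fin d → ℕ} {x : E d}
    (h : ‖c • x - site i₀ κ t‖ ≤ r) (i : Fin d) :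
    |c * x i - (8 * t i + if i = i₀ then κ else 0)| ≤ r := by
  have := (abs_coord_le_norm (c • x - site i₀ κ t) i).trans h
  simpa [site_apply] using this

/-- Balls of the two families never meet, whatever their generations. -/
lemma site_families_disjoint {d R m : ℕ} (hR : 16 * m + 1 ≤ R) {i₀ : Fin d} {n k : ℕ}
    {t t' : Fin d → ℕ} (ht : t ∈ nodes d R m n) (ht' : t' ∈ nodes d R m k) {x : E d}
    (h1 : ‖(R : ℝ) ^ n • x - site i₀ 2 t‖ ≤ 1 / 2)
    (h2 : ‖(R : ℝ) ^ k • x - site i₀ (-2) t'‖ ≤ 1 / 2) : False := by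
  have h1' := abs_coord_sub_site_le h1 i₀
  have h2' := abs_coord_sub_site_le h2 i₀
  rw [if_pos rfl] at h1' h2'
  exact digits_right_left_separated hR (mem_nodes.1 ht i₀) (mem_nodes.1 ht' i₀) h1'
    (by rw [sub_eq_add_neg (8 * (t' i₀ : ℝ))]; exact h2')

/-- Distinct nodes of one generation have sites at distance at least `8`. -/
lemma le_norm_site_sub_site {d : ℕ} {i₀ : Fin d} {κ : ℝ} {t t' : Fin d → ℕ} (h : t ≠ t') :
    8 ≤ ‖site i₀ κ t - site i₀ κ t'‖ := by
  obtain ⟨i, hi⟩ := Function.ne_iff.1 h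
  refine le_trans ?_ (abs_coord_le_norm _ i)
  have h1 : (site i₀ κ t - site i₀ κ t') i = 8 * (((t i : ℤ) - t' i : ℤ) : ℝ) := by
    simp only [PiLp.sub_apply, site_apply]; push_cast; ring
  rw [h1, abs_mul, abs_of_pos (by norm_num : (0 : ℝ) < 8)]
  have h2 : 1 ≤ |(t i : ℤ) - t' i| := Int.one_le_abs (by omega)
  have h3 : (1 : ℝ) ≤ |(((t i : ℤ) - t' i : ℤ) : ℝ)| := by exact_mod_cast h2
  linarith

lemma eq_of_norm_sub_site_le {d : ℕ} {i₀ : Fin d} {κ : ℝ} {t t' : Fin d → ℕ} {y : E d}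
    (h : ‖y - site i₀ κ t‖ ≤ 1 / 2) (h' : ‖y - site i₀ κ t'‖ ≤ 1 / 2) : t = t' := by
  by_contra hne
  have h1 := le_norm_site_sub_site (i₀ := i₀) (κ := κ) hne
  have h2 : site i₀ κ t - site i₀ κ t' = (y - site i₀ κ t') - (y - site i₀ κ t) := by abel
  rw [h2] at h1
  have := norm_sub_le (y - site i₀ κ t') (y - site i₀ κ t)
  linarith

/-- All balls lie in the cube `(-3, 3)^d`. -/
lemma mem_cube_three_of_norm_sub_site_le {d R m : ℕ} (hR : 16 * m + 1 ≤ R) {i₀ : Fin d} {κ : ℝ}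
    (hκ : |κ| ≤ 2) {n : ℕ} {t : Fin d → ℕ} (ht : t ∈ nodes d R m n) {x : E d}
    (h : ‖(R : ℝ) ^ n • x - site i₀ κ t‖ ≤ 1 / 2) : x ∈ cube d 3 := by
  intro i
  have hi := abs_coord_sub_site_le h i
  have hR1 : (1 : ℝ) ≤ R := by exact_mod_cast (by omega : 1 ≤ R)
  have hP1 : (1 : ℝ) ≤ (R : ℝ) ^ n := one_le_pow₀ hR1
  have ht' : 16 * (t i : ℝ) + 1 ≤ (R : ℝ) ^ n := by exact_mod_cast digits_lt hR (mem_nodes.1 ht i)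
  have ht0 : (0 : ℝ) ≤ t i := Nat.cast_nonneg _
  have hκ' : |if i = i₀ then κ else 0| ≤ 2 := by split_ifs <;> simp [hκ]
  set s := if i = i₀ then κ else 0
  rw [abs_le] at hi hκ'
  set P := (R : ℝ) ^ n
  rw [abs_lt]
  constructor
  · by_contra! hc
    have := mul_le_mul_of_nonneg_left hc (by linarith : (0 : ℝ) ≤ P)
    linarith
  · by_contra! hc
    have := mul_le_mul_of_nonneg_left hc (by linarith : (0 : ℝ) ≤ P)
    linarith

/-- From generation one on, the balls lie in the unit cube. -/
lemma mem_cube_one_of_norm_sub_site_le {d R m : ℕ} (hm : 1 ≤ m) (hR : 16 * m + 1 ≤ R)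
    {i₀ : Fin d} {κ : ℝ} (hκ : |κ| ≤ 2) {n : ℕ} (hn : n ≠ 0) {t : Fin d → ℕ}
    (ht : t ∈ nodes d R m n) {x : E d}
    (h : ‖(R : ℝ) ^ n • x - site i₀ κ t‖ ≤ 1 / 2) : x ∈ cube d 1 := by
  intro i
  have hi := abs_coord_sub_site_le h i
  have hR1 : (17 : ℝ) ≤ R := by exact_mod_cast (by omega : 17 ≤ R)
  have hP1 : (17 : ℝ) ≤ (R : ℝ) ^ n := hR1.trans (le_self_pow₀ (by linarith) hn)
  have ht' : 16 * (t i : ℝ) + 1 ≤ (R : ℝ) ^ n := by exact_mod_cast digits_lt hR (mem_nodes.1 ht i)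
  have ht0 : (0 : ℝ) ≤ t i := Nat.cast_nonneg _
  have hκ' : |if i = i₀ then κ else 0| ≤ 2 := by split_ifs <;> simp [hκ]
  set s := if i = i₀ then κ else 0
  rw [abs_le] at hi hκ'
  set P := (R : ℝ) ^ n
  rw [abs_lt]
  constructor
  · by_contra! hc
    have := mul_le_mul_of_nonneg_left hc (by linarith : (0 : ℝ) ≤ P)
    linarith
  · by_contra! hc
    have := mul_le_mul_of_nonneg_left hc (by linarith : (0 : ℝ) ≤ P)
    linarith

/-- The balls of generation zero lie outside the unit cube. -/
lemma notMem_cube_one_of_norm_sub_site_zero_le {d : ℕ} {i₀ : Fin d} {κ : ℝ} (hκ : |κ| = 2)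
    {x : E d} (h : ‖x - site i₀ κ 0‖ ≤ 1 / 2) : x ∉ cube d 1 := by
  intro hx
  have h0 : ‖(1 : ℝ) • x - site i₀ κ 0‖ ≤ 1 / 2 := by rwa [one_smul]
  have hi := abs_coord_sub_site_le h0 i₀
  have hx' := hx i₀
  simp only [one_mul, Pi.zero_apply, Nat.cast_zero, mul_zero, zero_add, if_true] at hi
  rw [abs_le] at hi
  rw [abs_lt] at hx'
  rcases abs_choice κ with h | h <;> rw [h] at hκ <;> linarith

/-! ### The weight and its Hölder regularity -/

/-- `f` is smooth and oscillates at the scale `1 / r`: its derivative of order `j` is bounded by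
`C j * r ^ j`. -/
structure ScaledBounds {F : Type*} [NormedAddCommGroup F] [NormedSpace ℝ F] (C : ℕ → ℝ) (r : ℝ)
    (f : F → ℝ) : Prop where
  contDiff : ContDiff ℝ ∞ f
  bound : ∀ j x, ‖iteratedFDeriv ℝ j f x‖ ≤ C j * r ^ j

section ScaledBounds

variable {F G : Type*} [NormedAddCommGroup F] [NormedSpace ℝ F] [NormedAddCommGroup G]
  [NormedSpace ℝ G] {C C' : ℕ → ℝ} {r : ℝ} {f g : F → ℝ}

lemma ScaledBounds.add (hf : ScaledBounds C r f) (hg : ScaledBounds C' r g) :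
    ScaledBounds (fun j => C j + C' j) r (fun x => f x + g x) := by
  refine ⟨hf.contDiff.add hg.contDiff, fun j x => ?_⟩
  have h : iteratedFDeriv ℝ j (fun x => f x + g x) x =
      iteratedFDeriv ℝ j f x + iteratedFDeriv ℝ j g x :=
    iteratedFDeriv_add_apply (hf.contDiff.of_le (mod_cast le_top)).contDiffAt
      (hg.contDiff.of_le (mod_cast le_top)).contDiffAt
  rw [h, add_mul]
  exact (norm_add_le _ _).trans (add_le_add (hf.bound j x) (hg.bound j x))

lemma ScaledBounds.const_mul (hf : ScaledBounds C r f) (c : ℝ) :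
    ScaledBounds (fun j => |c| * C j) r (fun x => c * f x) := by
  refine ⟨contDiff_const.mul hf.contDiff, fun j x => ?_⟩
  have h : iteratedFDeriv ℝ j (fun x => c * f x) x = c • iteratedFDeriv ℝ j f x :=
    iteratedFDeriv_const_smul_apply' (a := c) (f := f)
      (hf.contDiff.of_le (mod_cast le_top)).contDiffAt
  rw [h, norm_smul, Real.norm_eq_abs, mul_assoc]
  exact mul_le_mul_of_nonneg_left (hf.bound j x) (abs_nonneg c)

lemma ScaledBounds.mul (hr : 0 ≤ r) (hC : ∀ j, 0 ≤ C j) (hf : ScaledBounds C r f)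
    (hg : ScaledBounds C' r g) :
    ScaledBounds (fun j => ∑ i ∈ Finset.range (j + 1), (j.choose i : ℝ) * C i * C' (j - i)) r
      (fun x => f x * g x) := by
  refine ⟨hf.contDiff.mul hg.contDiff, fun j x => ?_⟩
  refine (norm_iteratedFDeriv_mul_le hf.contDiff hg.contDiff x (mod_cast le_top)).trans ?_
  rw [Finset.sum_mul]
  refine Finset.sum_le_sum fun i hi => ?_
  have hij : i ≤ j := by simpa [Nat.lt_succ_iff] using hi
  calc _ ≤ (j.choose i : ℝ) * (C i * r ^ i) * (C' (j - i) * r ^ (j - i)) := by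
        have := hC i
        refine mul_le_mul ?_ (hg.bound _ x) (norm_nonneg _) (by positivity)
        exact mul_le_mul_of_nonneg_left (hf.bound _ x) (Nat.cast_nonneg _)
    _ = _ := by
        have : r ^ j = r ^ i * r ^ (j - i) := by rw [← pow_add, Nat.add_sub_of_le hij]
        rw [this]; ring

lemma ScaledBounds.comp_clm (hr : 0 ≤ r) (hC : ∀ j, 0 ≤ C j) (hf : ScaledBounds C r f)
    (L : G →L[ℝ] F) (hL : ‖L‖ ≤ 1) : ScaledBounds C r (fun x => f (L x)) := by
  refine ⟨hf.contDiff.comp L.contDiff, fun j x => ?_⟩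
  have h := L.iteratedFDeriv_comp_right hf.contDiff x (i := j) (mod_cast le_top)
  have h' : iteratedFDeriv ℝ j (fun x => f (L x)) x =
      (iteratedFDeriv ℝ j f (L x)).compContinuousLinearMap fun _ => L := h
  rw [h']
  refine (ContinuousMultilinearMap.norm_compContinuousLinearMap_le _ _).trans ?_
  have h1 : ∏ _i : Fin j, ‖L‖ ≤ 1 := by
    rw [Finset.prod_const]; exact pow_le_one₀ (norm_nonneg _) hL
  calc _ ≤ (C j * r ^ j) * 1 := by
        have := hC j
        exact mul_le_mul (hf.bound j _) h1 (by positivity) (by positivity)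
    _ = _ := mul_one _

/-- A lacunary series `∑ R ^ (-α' n) g_n` with `g_n` oscillating at scale `R ^ (-n)` belongs to
`C^α` for every `α < α'`. The strict inequality makes all series of derivatives converge
geometrically, also for integer `α`. -/
lemma holderClass_tsum {d : ℕ} {α α' R : ℝ} (hα : 0 < α) (hαα' : α < α') (hR : 1 < R)
    (hC : ∀ j, 0 ≤ C j) {g : ℕ → E d × E d → ℝ} (hg : ∀ n, ScaledBounds C (R ^ n) (g n)) :
    HolderClass α (fun z => ∑' n, (R ^ (-α')) ^ n * g n z) := by
  have hR0 : 0 < R := by linarith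
  set ρ : ℝ := R ^ (-α') with hρ
  have hρ0 : 0 < ρ := Real.rpow_pos_of_pos hR0 _
  set k := ⌊α⌋₊ with hk
  have hkα : (k : ℝ) ≤ α := Nat.floor_le hα.le
  have hαk : α < k + 1 := Nat.lt_floor_add_one α
  set h : ℕ → E d × E d → ℝ := fun n z => ρ ^ n * g n z with hh
  have hh' : ∀ n, ScaledBounds (fun j => |ρ ^ n| * C j) (R ^ n) (h n) := fun n =>
    (hg n).const_mul _
  have hbound : ∀ j n z, ‖iteratedFDeriv ℝ j (h n) z‖ ≤ C j * (ρ * R ^ j) ^ n := by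
    intro j n z
    refine ((hh' n).bound j z).trans_eq ?_
    rw [abs_of_pos (pow_pos hρ0 n), mul_pow, ← pow_mul, ← pow_mul, mul_comm j n]
    ring
  have hratio : ∀ j : ℕ, j ≤ k → ρ * R ^ j < 1 := by
    intro j hj
    have hj' : (j : ℝ) ≤ k := by exact_mod_cast hj
    rw [hρ, ← Real.rpow_natCast, ← Real.rpow_add hR0]
    exact Real.rpow_lt_one_of_one_lt_of_neg hR (by linarith)
  have hsumm : ∀ j : ℕ, j ≤ k → Summable fun n => C j * (ρ * R ^ j) ^ n := fun j hj =>
    (summable_geometric_of_lt_one (by positivity) (hratio j hj)).mul_left _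
  have hcd : ∀ n, ContDiff ℝ ((k : ℕ∞) : ℕ∞ω) (h n) := fun n =>
    (hh' n).contDiff.of_le (mod_cast le_top)
  have hD : ∀ j : ℕ, j ≤ k → ∀ z, iteratedFDeriv ℝ j (fun z => ∑' n, h n z) z =
      ∑' n, iteratedFDeriv ℝ j (h n) z := fun j hj z =>
    iteratedFDeriv_tsum_apply (N := (k : ℕ∞)) hcd (v := fun j n => C j * (ρ * R ^ j) ^ n)
      (fun i hi => hsumm i (by exact_mod_cast hi)) (fun i n z _ => hbound i n z)
      (by exact_mod_cast hj) z
  refine ⟨?_, fun j hj => ?_, ?_⟩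
  · have := contDiff_tsum (N := (k : ℕ∞)) hcd (v := fun j n => C j * (ρ * R ^ j) ^ n)
      (fun i hi => hsumm i (by exact_mod_cast hi)) (fun i n z _ => hbound i n z)
    exact_mod_cast this
  · refine ⟨∑' n, C j * (ρ * R ^ j) ^ n, fun z => ?_⟩
    rw [hD j hj]
    exact tsum_of_norm_bounded (hsumm j hj).hasSum fun n => hbound j n z
  · set θ := α - k with hθ
    have hθ0 : 0 ≤ θ := by linarith
    set K := 2 * C k + C (k + 1) with hK
    have hK0 : 0 ≤ K := by linarith [hC k, hC (k + 1)]
    set τ := ρ * R ^ k * R ^ θ with hτ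
    have hτ0 : 0 ≤ τ := by positivity
    have hτ1 : τ < 1 := by
      rw [hτ, hρ, ← Real.rpow_natCast, ← Real.rpow_add hR0, ← Real.rpow_add hR0]
      exact Real.rpow_lt_one_of_one_lt_of_neg hR (by linarith)
    have hgeo : Summable fun n => τ ^ n := summable_geometric_of_lt_one hτ0 hτ1
    refine ⟨K * ∑' n, τ ^ n, fun z z' => ?_⟩
    have hs1 : Summable fun n => iteratedFDeriv ℝ k (h n) z :=
      Summable.of_norm_bounded (hsumm k le_rfl) fun n => hbound k n z
    have hs2 : Summable fun n => iteratedFDeriv ℝ k (h n) z' :=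
      Summable.of_norm_bounded (hsumm k le_rfl) fun n => hbound k n z'
    rw [hD k le_rfl, hD k le_rfl, ← hs1.tsum_sub hs2]
    have hterm : ∀ n, ‖iteratedFDeriv ℝ k (h n) z - iteratedFDeriv ℝ k (h n) z'‖ ≤
        K * ‖z - z'‖ ^ θ * τ ^ n := by
      intro n
      set s := ‖z - z'‖ with hs
      have hs0 : 0 ≤ s := norm_nonneg _
      set A := (ρ * R ^ k) ^ n with hA
      have hA0 : 0 ≤ A := by positivity
      have b1 : ‖iteratedFDeriv ℝ k (h n) z - iteratedFDeriv ℝ k (h n) z'‖ ≤ K * A := by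
        refine (norm_sub_le _ _).trans ?_
        have e1 := hbound k n z
        have e2 := hbound k n z'
        have := mul_nonneg (hC (k + 1)) hA0
        calc _ ≤ C k * A + C k * A := add_le_add e1 e2
          _ ≤ K * A := by rw [hK]; linarith
      have b2 : ‖iteratedFDeriv ℝ k (h n) z - iteratedFDeriv ℝ k (h n) z'‖ ≤
          K * A * (R ^ n * s) := by
        have hlip : ‖iteratedFDeriv ℝ k (h n) z - iteratedFDeriv ℝ k (h n) z'‖ ≤
            C (k + 1) * (ρ * R ^ (k + 1)) ^ n * ‖z - z'‖ := by
          refine convex_univ.norm_image_sub_le_of_norm_fderiv_le (𝕜 := ℝ)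
            (f := iteratedFDeriv ℝ k (h n)) (fun x _ => ?_) (fun x _ => ?_)
            (Set.mem_univ z') (Set.mem_univ z)
          · exact ((hh' n).contDiff.differentiable_iteratedFDeriv
              (WithTop.coe_lt_coe.2 (ENat.natCast_lt_top k))).differentiableAt
          · rw [norm_fderiv_iteratedFDeriv]; exact hbound (k + 1) n x
        refine hlip.trans ?_
        have e : (ρ * R ^ (k + 1)) ^ n = A * R ^ n := by
          rw [hA, ← mul_pow]; ring
        rw [e]
        have : C (k + 1) ≤ K := by rw [hK]; linarith [hC k]
        calc C (k + 1) * (A * R ^ n) * s ≤ K * (A * R ^ n) * s := by gcongr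
          _ = _ := by ring
      have hθs : τ ^ n * s ^ θ = A * (R ^ n * s) ^ θ := by
        rw [hτ, mul_pow _ (R ^ θ), Real.mul_rpow (by positivity) hs0, Real.rpow_pow_comm hR0.le]
        ring
      have hu : min 1 (R ^ n * s) ≤ (R ^ n * s) ^ θ := by
        have hu0 : 0 ≤ R ^ n * s := by positivity
        rcases le_total 1 (R ^ n * s) with h1 | h1
        · exact (min_le_left _ _).trans (Real.one_le_rpow h1 hθ0)
        · refine (min_le_right _ _).trans ?_
          rcases hu0.eq_or_lt with h0 | h0
          · rw [← h0]; exact Real.rpow_nonneg le_rfl _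
          · calc R ^ n * s = (R ^ n * s) ^ (1 : ℝ) := (Real.rpow_one _).symm
              _ ≤ _ := Real.rpow_le_rpow_of_exponent_ge h0 h1 (by linarith)
      calc _ ≤ K * A * min 1 (R ^ n * s) := by
            rcases min_choice 1 (R ^ n * s) with h | h <;> rw [h]
            · rw [mul_one]; exact b1
            · exact b2
        _ ≤ K * A * (R ^ n * s) ^ θ := mul_le_mul_of_nonneg_left hu (by positivity)
        _ = K * s ^ θ * τ ^ n := by rw [mul_assoc, ← hθs]; ring
    have := tsum_of_norm_bounded (hgeo.mul_left (K * ‖z - z'‖ ^ θ)).hasSum hterm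
    rw [tsum_mul_left] at this
    calc _ ≤ _ := this
      _ = _ := by ring

end ScaledBounds

/-- A smooth bump on `ℝ^d`, equal to `1` on the ball of radius `1 / 8` and supported in the ball of
radius `1 / 4`, from which the weight is built. -/
def smallBump (d : ℕ) : ContDiffBump (0 : E d) := ⟨1 / 8, 1 / 4, by norm_num, by norm_num⟩

/-- A smooth bump on `ℝ^d`, equal to `1` on the support of `smallBump` and supported in the ball of
radius `1 / 2`, from which the boundary datum and the competitor are built. -/
def largeBump (d : ℕ) : ContDiffBump (0 : E d) := ⟨1 / 4, 1 / 2, by norm_num, by norm_num⟩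

lemma smallBump_eq_one {d : ℕ} {x : E d} (h : ‖x‖ ≤ 1 / 8) : smallBump d x = 1 :=
  (smallBump d).one_of_mem_closedBall (by simpa [smallBump] using h)

lemma norm_le_of_smallBump_ne_zero {d : ℕ} {x : E d} (h : smallBump d x ≠ 0) : ‖x‖ ≤ 1 / 4 := by
  by_contra! hc
  exact h ((smallBump d).zero_of_le_dist (by simpa [smallBump] using hc.le))

lemma largeBump_eq_one {d : ℕ} {x : E d} (h : ‖x‖ ≤ 1 / 4) : largeBump d x = 1 :=
  (largeBump d).one_of_mem_closedBall (by simpa [largeBump] using h)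

lemma norm_le_of_largeBump_ne_zero {d : ℕ} {x : E d} (h : largeBump d x ≠ 0) : ‖x‖ ≤ 1 / 2 := by
  by_contra! hc
  exact h ((largeBump d).zero_of_le_dist (by simpa [largeBump] using hc.le))

/-- The sum of the bumps around all sites of generation `n` of the family `κ`, a smooth version of
the indicator function of the union of balls of radius comparable to `R ^ (-n)` about them. -/
def layer {d : ℕ} (R m : ℕ) (i₀ : Fin d) (κ : ℝ) (n : ℕ) (x : E d) : ℝ :=
  ∑ t ∈ nodes d R m n, smallBump d ((R : ℝ) ^ n • x - site i₀ κ t)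

lemma layer_nonneg {d : ℕ} (R m : ℕ) (i₀ : Fin d) (κ : ℝ) (n : ℕ) (x : E d) :
    0 ≤ layer R m i₀ κ n x :=
  Finset.sum_nonneg fun _ _ => (smallBump d).nonneg

lemma layer_le_one {d : ℕ} (R m : ℕ) (i₀ : Fin d) (κ : ℝ) (n : ℕ) (x : E d) :
    layer R m i₀ κ n x ≤ 1 := by
  by_cases h : ∃ t ∈ nodes d R m n, smallBump d ((R : ℝ) ^ n • x - site i₀ κ t) ≠ 0
  · obtain ⟨t, ht, h0⟩ := h
    unfold layer
    rw [Finset.sum_eq_single_of_mem t ht]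
    · exact (smallBump d).le_one
    · intro t' _ hne
      by_contra h0'
      have a := norm_le_of_smallBump_ne_zero h0
      have a' := norm_le_of_smallBump_ne_zero h0'
      exact hne (eq_of_norm_sub_site_le (a'.trans (by norm_num)) (a.trans (by norm_num)))
  · push Not at h
    unfold layer
    rw [Finset.sum_eq_zero h]
    exact zero_le_one

lemma one_le_layer {d : ℕ} {R m : ℕ} {i₀ : Fin d} {κ : ℝ} {n : ℕ} {t : Fin d → ℕ}
    (ht : t ∈ nodes d R m n) {x : E d} (h : ‖(R : ℝ) ^ n • x - site i₀ κ t‖ ≤ 1 / 8) :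
    1 ≤ layer R m i₀ κ n x := by
  rw [← smallBump_eq_one h]
  exact Finset.single_le_sum
    (f := fun t => smallBump d ((R : ℝ) ^ n • x - site i₀ κ t))
    (fun _ _ => (smallBump d).nonneg) ht

lemma exists_of_layer_ne_zero {d : ℕ} {R m : ℕ} {i₀ : Fin d} {κ : ℝ} {n : ℕ} {x : E d}
    (h : layer R m i₀ κ n x ≠ 0) :
    ∃ t ∈ nodes d R m n, ‖(R : ℝ) ^ n • x - site i₀ κ t‖ ≤ 1 / 4 := by
  obtain ⟨t, ht, h0⟩ := Finset.exists_ne_zero_of_sum_ne_zero h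
  exact ⟨t, ht, norm_le_of_smallBump_ne_zero h0⟩

/-- A sum of bumps at separated sites has derivatives bounded independently of their number,
because at every point at most one summand contributes. -/
lemma exists_scaledBounds_layer (d : ℕ) : ∃ C : ℕ → ℝ, (∀ j, 0 ≤ C j) ∧
    ∀ (R m : ℕ) (i₀ : Fin d) (κ : ℝ) (n : ℕ),
      ScaledBounds C ((R : ℝ) ^ n) (layer R m i₀ κ n) := by
  have hψ : ContDiff ℝ ∞ (smallBump d) := (smallBump d).contDiff
  have hex : ∀ j : ℕ, ∃ C : ℝ, ∀ x, ‖iteratedFDeriv ℝ j (smallBump d) x‖ ≤ C := fun j =>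
    ((smallBump d).hasCompactSupport.iteratedFDeriv j).exists_bound_of_continuous
      (hψ.continuous_iteratedFDeriv (mod_cast le_top))
  choose C hC using hex
  have hC0 : ∀ j, 0 ≤ C j := fun j => (norm_nonneg _).trans (hC j 0)
  refine ⟨C, hC0, fun R m i₀ κ n => ?_⟩
  set S : E d → ℝ := fun y => ∑ t ∈ nodes d R m n, smallBump d (y - site i₀ κ t) with hS
  have hcdt : ∀ t, ContDiff ℝ ∞ fun y => smallBump d (y - site i₀ κ t) := fun t =>
    hψ.comp (contDiff_id.sub contDiff_const)
  have hScd : ContDiff ℝ ∞ S := ContDiff.sum fun t _ => hcdt t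
  have hSb : ∀ j y, ‖iteratedFDeriv ℝ j S y‖ ≤ C j := by
    intro j y
    rw [hS, iteratedFDeriv_fun_sum_apply
      fun t _ => ((hcdt t).of_le (mod_cast le_top)).contDiffAt]
    simp_rw [iteratedFDeriv_comp_sub]
    by_cases h : ∃ t ∈ nodes d R m n, iteratedFDeriv ℝ j (smallBump d) (y - site i₀ κ t) ≠ 0
    · obtain ⟨t, ht, h0⟩ := h
      have hnear : ∀ t, iteratedFDeriv ℝ j (smallBump d) (y - site i₀ κ t) ≠ 0 →
          ‖y - site i₀ κ t‖ ≤ 1 / 2 := by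
        intro t h
        have := support_iteratedFDeriv_subset (𝕜 := ℝ) j h
        rw [(smallBump d).tsupport_eq, mem_closedBall_zero_iff] at this
        exact this.trans (by norm_num [smallBump])
      rw [Finset.sum_eq_single_of_mem t ht]
      · exact hC j _
      · intro t' _ hne
        by_contra h0'
        exact hne (eq_of_norm_sub_site_le (hnear t' h0') (hnear t h0))
    · push Not at h
      rw [Finset.sum_eq_zero h, norm_zero]
      exact hC0 j
  have hlayer : layer R m i₀ κ n = fun x => S ((R : ℝ) ^ n • x) := rfl
  rw [hlayer]
  refine ⟨hScd.comp (contDiff_const_smul ((R : ℝ) ^ n)), fun j x => ?_⟩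
  rw [iteratedFDeriv_comp_const_smul _ (hScd.of_le (mod_cast le_top)), norm_smul, norm_pow,
    Real.norm_of_nonneg (by positivity), mul_comm]
  exact mul_le_mul_of_nonneg_right (hSb j _) (by positivity)

/-- The coupling between the generations `n` and `n + 1` within the family `κ`. -/
def coupling {d : ℕ} (R m : ℕ) (i₀ : Fin d) (κ : ℝ) (n : ℕ) (z : E d × E d) : ℝ :=
  layer R m i₀ κ n z.1 * layer R m i₀ κ (n + 1) z.2 +
    layer R m i₀ κ (n + 1) z.1 * layer R m i₀ κ n z.2

lemma coupling_nonneg {d : ℕ} (R m : ℕ) (i₀ : Fin d) (κ : ℝ) (n : ℕ) (z : E d × E d) :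
    0 ≤ coupling R m i₀ κ n z :=
  add_nonneg (mul_nonneg (layer_nonneg ..) (layer_nonneg ..))
    (mul_nonneg (layer_nonneg ..) (layer_nonneg ..))

lemma coupling_le_two {d : ℕ} (R m : ℕ) (i₀ : Fin d) (κ : ℝ) (n : ℕ) (z : E d × E d) :
    coupling R m i₀ κ n z ≤ 2 := by
  have h1 := mul_le_one₀ (layer_le_one R m i₀ κ n z.1) (layer_nonneg R m i₀ κ (n + 1) z.2)
    (layer_le_one R m i₀ κ (n + 1) z.2)
  have h2 := mul_le_one₀ (layer_le_one R m i₀ κ (n + 1) z.1) (layer_nonneg R m i₀ κ n z.2)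
    (layer_le_one R m i₀ κ n z.2)
  unfold coupling
  linarith

lemma coupling_swap {d : ℕ} (R m : ℕ) (i₀ : Fin d) (κ : ℝ) (n : ℕ) (x y : E d) :
    coupling R m i₀ κ n (x, y) = coupling R m i₀ κ n (y, x) := by
  simp only [coupling]; ring

lemma exists_near_site_of_coupling_ne_zero {d : ℕ} {R m : ℕ} {i₀ : Fin d} {κ : ℝ} {n : ℕ}
    {z : E d × E d} (h : coupling R m i₀ κ n z ≠ 0) :
    (∃ k, ∃ t ∈ nodes d R m k, ‖(R : ℝ) ^ k • z.1 - site i₀ κ t‖ ≤ 1 / 4) ∧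
      ∃ k, ∃ t ∈ nodes d R m k, ‖(R : ℝ) ^ k • z.2 - site i₀ κ t‖ ≤ 1 / 4 := by
  by_cases h1 : layer R m i₀ κ n z.1 * layer R m i₀ κ (n + 1) z.2 = 0
  · have h2 : layer R m i₀ κ (n + 1) z.1 * layer R m i₀ κ n z.2 ≠ 0 := by
      intro h2; exact h (by simp [coupling, h1, h2])
    exact ⟨⟨n + 1, exists_of_layer_ne_zero (left_ne_zero_of_mul h2)⟩,
      ⟨n, exists_of_layer_ne_zero (right_ne_zero_of_mul h2)⟩⟩
  · exact ⟨⟨n, exists_of_layer_ne_zero (left_ne_zero_of_mul h1)⟩,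
      ⟨n + 1, exists_of_layer_ne_zero (right_ne_zero_of_mul h1)⟩⟩

lemma one_le_coupling {d : ℕ} {R m : ℕ} {i₀ : Fin d} {κ : ℝ} {n : ℕ} {t t' : Fin d → ℕ}
    (ht : t ∈ nodes d R m n) (ht' : t' ∈ nodes d R m (n + 1)) {x y : E d}
    (hx : ‖(R : ℝ) ^ n • x - site i₀ κ t‖ ≤ 1 / 8)
    (hy : ‖(R : ℝ) ^ (n + 1) • y - site i₀ κ t'‖ ≤ 1 / 8) :
    1 ≤ coupling R m i₀ κ n (x, y) := by
  have h1 := one_le_mul_of_one_le_of_one_le (one_le_layer ht hx) (one_le_layer ht' hy)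
  have h2 := mul_nonneg (layer_nonneg R m i₀ κ (n + 1) x) (layer_nonneg R m i₀ κ n y)
  simp only [coupling]
  linarith

/-- The weight: consecutive generations are coupled within each of the two families, with strength
`R ^ (-α n)`, and there is no coupling between the families. -/
def weight {d : ℕ} (R m : ℕ) (i₀ : Fin d) (α : ℝ) (z : E d × E d) : ℝ :=
  ∑' n, ((R : ℝ) ^ (-α)) ^ n * (coupling R m i₀ 2 n z + coupling R m i₀ (-2) n z)

lemma holderClass_const_mul_weight {d R m : ℕ} (hR : 1 < R) (i₀ : Fin d) {α α' : ℝ} (hα : 0 < α)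
    (hαα' : α < α') (c : ℝ) : HolderClass α (fun z => c * weight R m i₀ α' z) := by
  obtain ⟨C, hC0, hC⟩ := exists_scaledBounds_layer d
  have hR0 : (0 : ℝ) ≤ R := Nat.cast_nonneg R
  set C' : ℕ → ℝ := fun j => C j * (R : ℝ) ^ j
  have hC'0 : ∀ j, 0 ≤ C' j := fun j => mul_nonneg (hC0 j) (by positivity)
  have hsucc : ∀ κ n, ScaledBounds C' ((R : ℝ) ^ n) (layer R m i₀ κ (n + 1)) := fun κ n =>
    ⟨(hC R m i₀ κ (n + 1)).contDiff, fun j x => ((hC R m i₀ κ (n + 1)).bound j x).trans_eq (by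
      simp only [C']; rw [pow_succ, mul_pow]; ring)⟩
  set D : ℕ → ℝ := fun j =>
    (∑ i ∈ Finset.range (j + 1), (j.choose i : ℝ) * C i * C' (j - i)) +
      ∑ i ∈ Finset.range (j + 1), (j.choose i : ℝ) * C' i * C (j - i)
  have hD0 : ∀ j, 0 ≤ D j := fun j => add_nonneg
    (Finset.sum_nonneg fun i _ => mul_nonneg (mul_nonneg (Nat.cast_nonneg _) (hC0 i)) (hC'0 _))
    (Finset.sum_nonneg fun i _ => mul_nonneg (mul_nonneg (Nat.cast_nonneg _) (hC'0 i)) (hC0 _))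
  have hcoup : ∀ κ n, ScaledBounds D ((R : ℝ) ^ n) (coupling R m i₀ κ n) := by
    intro κ n
    have hr : (0 : ℝ) ≤ (R : ℝ) ^ n := by positivity
    have f1 := ContinuousLinearMap.norm_fst_le (𝕜 := ℝ) (E := E d) (F := E d)
    have f2 := ContinuousLinearMap.norm_snd_le (𝕜 := ℝ) (E := E d) (F := E d)
    have a1 := (hC R m i₀ κ n).comp_clm hr hC0 _ f1
    have a2 := (hC R m i₀ κ n).comp_clm hr hC0 _ f2
    have b1 := (hsucc κ n).comp_clm hr hC'0 _ f1
    have b2 := (hsucc κ n).comp_clm hr hC'0 _ f2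
    exact (a1.mul hr hC0 b2).add (b1.mul hr hC'0 a2)
  have := holderClass_tsum hα hαα' (by exact_mod_cast hR : (1 : ℝ) < R)
    (C := fun j => |c| * (D j + D j))
    (fun j => mul_nonneg (abs_nonneg c) (add_nonneg (hD0 j) (hD0 j)))
    (fun n => ((hcoup 2 n).add (hcoup (-2) n)).const_mul c)
  convert this using 2 with z
  rw [weight, ← tsum_mul_left]
  exact tsum_congr fun n => by ring

section Weight

variable {d R m : ℕ} {i₀ : Fin d} {α : ℝ}

lemma summable_weight (hR : 1 < R) (hα : 0 < α) (z : E d × E d) :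
    Summable fun n => ((R : ℝ) ^ (-α)) ^ n *
      (coupling R m i₀ 2 n z + coupling R m i₀ (-2) n z) := by
  have hR1 : (1 : ℝ) < R := by exact_mod_cast hR
  have hρ0 : 0 ≤ (R : ℝ) ^ (-α) := by positivity
  have hρ1 : (R : ℝ) ^ (-α) < 1 := Real.rpow_lt_one_of_one_lt_of_neg hR1 (by linarith)
  refine Summable.of_nonneg_of_le (fun n => ?_) (fun n => ?_)
    ((summable_geometric_of_lt_one hρ0 hρ1).mul_right 4)
  · exact mul_nonneg (by positivity) (add_nonneg (coupling_nonneg ..) (coupling_nonneg ..))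
  · refine mul_le_mul_of_nonneg_left ?_ (by positivity)
    linarith [coupling_le_two R m i₀ 2 n z, coupling_le_two R m i₀ (-2) n z]

lemma weight_nonneg (z : E d × E d) : 0 ≤ weight R m i₀ α z :=
  tsum_nonneg fun n =>
    mul_nonneg (by positivity) (add_nonneg (coupling_nonneg ..) (coupling_nonneg ..))

lemma exists_weight_le (hR : 1 < R) (hα : 0 < α) : ∃ M : ℝ, ∀ z, weight R m i₀ α z ≤ M := by
  have hR1 : (1 : ℝ) < R := by exact_mod_cast hR
  have hρ0 : 0 ≤ (R : ℝ) ^ (-α) := by positivity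
  have hρ1 : (R : ℝ) ^ (-α) < 1 := Real.rpow_lt_one_of_one_lt_of_neg hR1 (by linarith)
  refine ⟨∑' n, ((R : ℝ) ^ (-α)) ^ n * 4, fun z => ?_⟩
  refine (summable_weight hR hα z).tsum_le_tsum (fun n => ?_)
    ((summable_geometric_of_lt_one hρ0 hρ1).mul_right 4)
  refine mul_le_mul_of_nonneg_left ?_ (by positivity)
  linarith [coupling_le_two R m i₀ 2 n z, coupling_le_two R m i₀ (-2) n z]

lemma weight_swap (x y : E d) : weight R m i₀ α (x, y) = weight R m i₀ α (y, x) := by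
  unfold weight
  exact tsum_congr fun n => by rw [coupling_swap R m i₀ 2, coupling_swap R m i₀ (-2)]

lemma exists_near_sites_of_weight_ne_zero {z : E d × E d} (h : weight R m i₀ α z ≠ 0) :
    ∃ κ : ℝ, (κ = 2 ∨ κ = -2) ∧
      (∃ k, ∃ t ∈ nodes d R m k, ‖(R : ℝ) ^ k • z.1 - site i₀ κ t‖ ≤ 1 / 4) ∧
      ∃ k, ∃ t ∈ nodes d R m k, ‖(R : ℝ) ^ k • z.2 - site i₀ κ t‖ ≤ 1 / 4 := by
  by_contra! hc
  refine h ?_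
  unfold weight
  have : ∀ κ : ℝ, (κ = 2 ∨ κ = -2) → ∀ n, coupling R m i₀ κ n z = 0 := by
    intro κ hκ n
    by_contra hne
    obtain ⟨h1, k, t, ht, h2⟩ := exists_near_site_of_coupling_ne_zero hne
    exact absurd h2 (not_le.2 (hc κ hκ h1 k t ht))
  simp [this 2 (Or.inl rfl), this (-2) (Or.inr rfl)]

lemma weight_eq_zero_of_notMem (hR : 16 * m + 1 ≤ R) {x y : E d}
    (h : x ∉ cube d 3 ∨ y ∉ cube d 3) : weight R m i₀ α (x, y) = 0 := by
  by_contra hne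
  obtain ⟨κ, hκ, ⟨k, t, ht, h1⟩, k', t', ht', h2⟩ := exists_near_sites_of_weight_ne_zero hne
  have hκ' : |κ| ≤ 2 := by rcases hκ with rfl | rfl <;> norm_num
  rcases h with h | h
  · exact h (mem_cube_three_of_norm_sub_site_le hR hκ' ht (h1.trans (by norm_num)))
  · exact h (mem_cube_three_of_norm_sub_site_le hR hκ' ht' (h2.trans (by norm_num)))

lemma le_weight (hR : 1 < R) (hα : 0 < α) {κ : ℝ} (hκ : κ = 2 ∨ κ = -2) {n : ℕ}
    {t t' : Fin d → ℕ} (ht : t ∈ nodes d R m n) (ht' : t' ∈ nodes d R m (n + 1)) {x y : E d}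
    (hx : ‖(R : ℝ) ^ n • x - site i₀ κ t‖ ≤ 1 / 8)
    (hy : ‖(R : ℝ) ^ (n + 1) • y - site i₀ κ t'‖ ≤ 1 / 8) :
    ((R : ℝ) ^ (-α)) ^ n ≤ weight R m i₀ α (x, y) := by
  have h1 := one_le_coupling ht ht' hx hy
  have h2 : 1 ≤ coupling R m i₀ 2 n (x, y) + coupling R m i₀ (-2) n (x, y) := by
    rcases hκ with rfl | rfl
    · linarith [coupling_nonneg R m i₀ (-2) n (x, y)]
    · linarith [coupling_nonneg R m i₀ 2 n (x, y)]
  refine le_trans ?_ ((summable_weight hR hα (x, y)).le_tsum n fun j _ =>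
    mul_nonneg (by positivity) (add_nonneg (coupling_nonneg ..) (coupling_nonneg ..)))
  exact le_mul_of_one_le_right (by positivity) h2

lemma measurable_weight (hR : 1 < R) (hα : 0 < α) :
    Measurable (weight R m i₀ α : E d × E d → ℝ) := by
  have := (holderClass_const_mul_weight (m := m) hR i₀ (half_pos hα) (half_lt_self hα) 1).1
  simpa using this.continuous.measurable

end Weight

/-! ### The lower bound for continuous functions -/

section Branch

variable {d R m : ℕ}

/-- The box of radius `3 / R ^ n` around the node `t` of generation `n`. It contains all balls
attached to the node and the boxes of all its children. -/
def box {d : ℕ} (R n : ℕ) (t : Fin d → ℕ) : Set (E d) :=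
  {x | ∀ i, |(R : ℝ) ^ n * x i - 8 * t i| ≤ 3}

lemma measurableSet_box {n : ℕ} {t : Fin d → ℕ} : MeasurableSet (box R n t) := by
  have : IsClosed (box R n t) := by
    simp only [box, Set.ofPred_forall]
    refine isClosed_iInter fun i => isClosed_le ?_ continuous_const
    fun_prop
  exact this.measurableSet

lemma box_child_subset (hR : 16 * m + 1 ≤ R) {n : ℕ} {t : Fin d → ℕ} (j : Fin d → Fin m) :
    box R (n + 1) (fun i => R * t i + j i) ⊆ box R n t := by
  intro x hx i
  have h := hx i
  have hj : ((j i : ℕ) : ℝ) ≤ m := by exact_mod_cast (j i).2.le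
  have hj0 : (0 : ℝ) ≤ (j i : ℕ) := Nat.cast_nonneg _
  have hR' : 16 * (m : ℝ) + 1 ≤ R := by exact_mod_cast hR
  have hm : (1 : ℝ) ≤ m := by exact_mod_cast (j i).pos
  push_cast at h
  rw [pow_succ] at h
  set Y := (R : ℝ) ^ n * x i
  have e : (R : ℝ) ^ n * R * x i = R * Y := by simp only [Y]; ring
  rw [e, abs_le] at h
  rw [abs_le]
  constructor
  · by_contra! hc
    have := mul_lt_mul_of_pos_left hc (by linarith : (0 : ℝ) < R)
    linarith
  · by_contra! hc
    have := mul_lt_mul_of_pos_left hc (by linarith : (0 : ℝ) < R)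
    linarith

lemma disjoint_box_child {n : ℕ} {t : Fin d → ℕ} {j j' : Fin d → Fin m} (h : j ≠ j') :
    Disjoint (box R (n + 1) (fun i => R * t i + j i))
      (box R (n + 1) (fun i => R * t i + j' i)) := by
  rw [Set.disjoint_left]
  intro x hx hx'
  obtain ⟨i, hi⟩ := Function.ne_iff.1 h
  have h1 := hx i
  have h2 := hx' i
  push_cast at h1 h2
  rw [abs_le] at h1 h2
  rcases lt_or_gt_of_ne (Fin.val_ne_of_ne hi) with hlt | hlt
  · have : ((j i : ℕ) : ℝ) + 1 ≤ (j' i : ℕ) := by exact_mod_cast hlt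
    linarith
  · have : ((j' i : ℕ) : ℝ) + 1 ≤ (j i : ℕ) := by exact_mod_cast hlt
    linarith

lemma norm_sub_le_of_mem_box (hR : 1 ≤ R) {n : ℕ} {t : Fin d → ℕ} {x y : E d}
    (hx : x ∈ box R n t) (hy : y ∈ box R n t) : ‖x - y‖ ≤ 6 * d * ((R : ℝ) ^ n)⁻¹ := by
  have hP : (0 : ℝ) < (R : ℝ) ^ n := by
    have : (0 : ℝ) < R := by exact_mod_cast hR
    positivity
  have hi : ∀ i, ‖(x - y) i‖ ≤ 6 * ((R : ℝ) ^ n)⁻¹ := by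
    intro i
    have h1 := hx i
    have h2 := hy i
    rw [← div_eq_mul_inv, le_div_iff₀ hP, Real.norm_eq_abs, mul_comm]
    nth_rewrite 1 [← abs_of_pos hP]
    rw [← abs_mul, PiLp.sub_apply, mul_sub]
    rw [abs_le] at h1 h2 ⊢
    constructor <;> linarith
  calc ‖x - y‖ ≤ ∑ i, ‖(x - y) i‖ := by
        have h := (EuclideanSpace.basisFun (Fin d) ℝ).sum_repr (x - y)
        nth_rewrite 1 [← h]
        refine (norm_sum_le _ _).trans (Finset.sum_le_sum fun i _ => ?_)
        rw [norm_smul]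
        simp
    _ ≤ ∑ _i : Fin d, 6 * ((R : ℝ) ^ n)⁻¹ := Finset.sum_le_sum fun i _ => hi i
    _ = 6 * d * ((R : ℝ) ^ n)⁻¹ := by simp; ring

lemma mem_box_of_norm_sub_site_le {i₀ : Fin d} {κ : ℝ} (hκ : |κ| ≤ 2) {n : ℕ} {t : Fin d → ℕ}
    {x : E d} (h : ‖(R : ℝ) ^ n • x - site i₀ κ t‖ ≤ 1 / 8) : x ∈ box R n t := by
  intro i
  have hi := abs_coord_sub_site_le h i
  have hκ' : |if i = i₀ then κ else 0| ≤ 2 := by split_ifs <;> simp [hκ]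
  set s := if i = i₀ then κ else 0
  rw [abs_le] at hi hκ' ⊢
  constructor <;> linarith

/-- Among the children of a node, one carries at most the average share of a measure. -/
lemma exists_child_measure_le (hm : 1 ≤ m) (hR : 16 * m + 1 ≤ R) (μ : Measure (E d × E d))
    (n : ℕ) (t : Fin d → ℕ) : ∃ j : Fin d → Fin m,
      ((m ^ d : ℕ) : ℝ≥0∞) * μ (box R (n + 1) (fun i => R * t i + j i) ×ˢ
        box R (n + 1) (fun i => R * t i + j i)) ≤ μ (box R n t ×ˢ box R n t) := by
  have : NeZero m := ⟨by omega⟩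
  set Q : (Fin d → Fin m) → Set (E d × E d) := fun j =>
    box R (n + 1) (fun i => R * t i + j i) ×ˢ box R (n + 1) (fun i => R * t i + j i)
  obtain ⟨j, hj⟩ := Finite.exists_min fun j => μ (Q j)
  refine ⟨j, ?_⟩
  calc ((m ^ d : ℕ) : ℝ≥0∞) * μ (Q j) = ∑ _j' : Fin d → Fin m, μ (Q j) := by simp
    _ ≤ ∑ j', μ (Q j') := Finset.sum_le_sum fun j' _ => hj j'
    _ = μ (⋃ j' ∈ Finset.univ, Q j') := by
        rw [measure_biUnion_finset]
        · intro a _ b _ hab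
          exact Set.Disjoint.set_prod_left (disjoint_box_child hab) _ _
        · exact fun b _ => measurableSet_box.prod measurableSet_box
    _ ≤ μ (box R n t ×ˢ box R n t) := measure_mono <| Set.iUnion₂_subset fun j' _ =>
        Set.prod_mono (box_child_subset hR j') (box_child_subset hR j')

/-- An infinite branch of the tree of nodes along which a given measure on pairs decays at least as
fast as the number of nodes grows. -/
lemma exists_branch (hm : 1 ≤ m) (hR : 16 * m + 1 ≤ R) (μ : Measure (E d × E d)) :
    ∃ t : ℕ → Fin d → ℕ, t 0 = 0 ∧ (∀ n, t n ∈ nodes d R m n) ∧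
      (∀ n, box R (n + 1) (t (n + 1)) ⊆ box R n (t n)) ∧
      ∀ n, ((m ^ d : ℕ) : ℝ≥0∞) ^ n * μ (box R n (t n) ×ˢ box R n (t n)) ≤ μ Set.univ := by
  choose J hJ using exists_child_measure_le (R := R) hm hR μ
  set t : ℕ → Fin d → ℕ := fun n => Nat.rec 0 (fun n s i => R * s i + J n s i) n
  refine ⟨t, rfl, fun n => ?_, fun n => box_child_subset hR _, fun n => ?_⟩
  · induction n with
    | zero => exact zero_mem_nodes_zero
    | succ n ih => exact child_mem_nodes ih _
  · induction n with
    | zero => simpa using measure_mono (Set.subset_univ _)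
    | succ n ih =>
      refine le_trans ?_ ih
      rw [pow_succ, mul_assoc]
      exact mul_le_mul_right (hJ n (t n)) _

end Branch

/-- Propagation of a lower bound along a chain of sets: if at no step the function can drop by
`δ n` between the halves of consecutive sets, then on at least half of every set it has dropped by
at most the sum of the `δ k`. -/
lemma half_measure_le_of_chain {X : Type*} [MeasurableSpace X] {μ : Measure X} {I : ℕ → Set X}
    (hI : ∀ n, MeasurableSet (I n)) {v : X → ℝ} (hv : Measurable v)
    (h0 : ∀ x ∈ I 0, 1 ≤ v x) {δ : ℕ → ℝ}
    (hstep : ∀ n S S', MeasurableSet S → MeasurableSet S' → S ⊆ I n → S' ⊆ I (n + 1) →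
      μ (I n) / 2 ≤ μ S → μ (I (n + 1)) / 2 ≤ μ S' →
      (∀ x ∈ S, ∀ y ∈ S', δ n ≤ |v x - v y|) → False) (n : ℕ) :
    μ (I n) / 2 ≤ μ (I n ∩ {x | 1 - ∑ k ∈ Finset.range n, δ k ≤ v x}) := by
  induction n with
  | zero =>
    have : I 0 ∩ {x | 1 - ∑ k ∈ Finset.range 0, δ k ≤ v x} = I 0 := by
      refine Set.inter_eq_left.2 fun x hx => ?_
      simpa using h0 x hx
    rw [this]
    exact ENNReal.half_le_self
  | succ n ih =>
    by_contra! hlt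
    set a := 1 - ∑ k ∈ Finset.range (n + 1), δ k with ha
    have hmeas : MeasurableSet {x | a ≤ v x} := measurableSet_le measurable_const hv
    refine hstep n _ (I (n + 1) \ {x | a ≤ v x})
      ((hI n).inter (measurableSet_le measurable_const hv)) ((hI _).diff hmeas)
      Set.inter_subset_left Set.sdiff_subset ih ?_ ?_
    · by_contra! hlt'
      have h1 := measure_inter_add_sdiff (μ := μ) (I (n + 1)) hmeas
      have h2 := ENNReal.add_lt_add hlt hlt'
      rw [h1, ENNReal.add_halves] at h2
      exact lt_irrefl _ h2
    · intro x hx y hy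
      have h1 : 1 - ∑ k ∈ Finset.range n, δ k ≤ v x := hx.2
      have h2 : v y < a := not_le.1 hy.2
      rw [ha, Finset.sum_range_succ] at h2
      exact le_trans (by linarith) (le_abs_self _)

section LowerBound

variable {d R m : ℕ} {i₀ : Fin d}

/-- The ball of radius `R ^ (-n) / 8` about the site of the family `κ` at the node `t`. -/
def siteBall (R : ℕ) (i₀ : Fin d) (κ : ℝ) (n : ℕ) (t : Fin d → ℕ) : Set (E d) :=
  {x | ‖(R : ℝ) ^ n • x - site i₀ κ t‖ ≤ 1 / 8}

lemma siteBall_eq_closedBall (hR : 1 ≤ R) (κ : ℝ) (n : ℕ) (t : Fin d → ℕ) :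
    siteBall R i₀ κ n t =
      Metric.closedBall (((R : ℝ) ^ n)⁻¹ • site i₀ κ t) (((R : ℝ) ^ n)⁻¹ / 8) := by
  have hP : (0 : ℝ) < (R : ℝ) ^ n := by
    have : (0 : ℝ) < R := by exact_mod_cast hR
    positivity
  ext x
  have h : (R : ℝ) ^ n • x - site i₀ κ t =
      (R : ℝ) ^ n • (x - ((R : ℝ) ^ n)⁻¹ • site i₀ κ t) := by
    rw [smul_sub, smul_inv_smul₀ hP.ne']
  rw [siteBall, Set.mem_ofPred_eq, h, norm_smul, Real.norm_of_nonneg hP.le, Metric.mem_closedBall,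
    dist_eq_norm, ← le_div_iff₀' hP]
  rw [div_div, div_eq_mul_inv, div_eq_mul_inv, mul_inv, one_mul, mul_comm]

lemma volume_siteBall (hR : 1 ≤ R) (κ : ℝ) (n : ℕ) (t : Fin d → ℕ) :
    volume (siteBall R i₀ κ n t) = ENNReal.ofReal
      ((((R : ℝ) ^ n)⁻¹ / 8) ^ d * (volume (Metric.ball (0 : E d) 1)).toReal) := by
  rw [siteBall_eq_closedBall hR, Measure.addHaar_closedBall _ _ (by positivity),
    finrank_euclideanSpace, Fintype.card_fin, ENNReal.ofReal_mul (by positivity),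
    ENNReal.ofReal_toReal measure_ball_lt_top.ne]

/-- The energy needed for a drop by `δ σ ^ n` between halves of consecutive balls of a branch, times
the number `M ^ n` of nodes of generation `n`, does not depend on `n` if
`σ ^ q = R ^ (d + α - s q) / M`. This is the choice of `σ` that makes the energy bound along a branch
just strong enough to exclude such drops. -/
lemma chain_constant_eq {s q α δ σ V D : ℝ} {M : ℕ} (hM : 0 < M) (hR : 0 < R)
    (hσ : 0 < σ) (hδ : 0 ≤ δ) (hD : 0 < D)
    (hσq : σ ^ q = (R : ℝ) ^ (d + α - s * q) / M) (n : ℕ) :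
    (M : ℝ) ^ n * ((1 / q * ((R : ℝ) ^ (-α)) ^ n * (δ * σ ^ n) ^ q /
        (D * ((R : ℝ) ^ n)⁻¹) ^ (d + s * q)) *
      (((((R : ℝ) ^ n)⁻¹ / 8) ^ d * V / 2) * ((((R : ℝ) ^ (n + 1))⁻¹ / 8) ^ d * V / 2))) =
    1 / q * δ ^ q / D ^ (d + s * q) * (V ^ 2 / (4 * 64 ^ d * (R : ℝ) ^ d)) := by
  have hR0 : (0 : ℝ) < R := by exact_mod_cast hR
  have hM0 : (0 : ℝ) < M := by exact_mod_cast hM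
  have e1 : (δ * σ ^ n) ^ q = δ ^ q * ((R : ℝ) ^ (d + α - s * q) / M) ^ n := by
    rw [Real.mul_rpow hδ (by positivity), ← Real.rpow_pow_comm hσ.le, hσq]
  have e2 : (D * ((R : ℝ) ^ n)⁻¹) ^ (d + s * q) = D ^ (d + s * q) / ((R : ℝ) ^ (d + s * q)) ^ n := by
    rw [Real.mul_rpow hD.le (by positivity), Real.inv_rpow (by positivity),
      ← Real.rpow_pow_comm hR0.le, div_eq_mul_inv]
  have hkey : (M : ℝ) ^ n * ((R : ℝ) ^ (-α)) ^ n * ((R : ℝ) ^ (d + α - s * q) / M) ^ n *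
      ((R : ℝ) ^ (d + s * q)) ^ n = (((R : ℝ) ^ d) ^ n) ^ 2 := by
    rw [← mul_pow, ← mul_pow, ← mul_pow, ← pow_mul, ← pow_mul, mul_comm n 2, pow_mul, pow_mul]
    congr 1
    have : (M : ℝ) * (R : ℝ) ^ (-α) * ((R : ℝ) ^ (d + α - s * q) / M) * (R : ℝ) ^ (d + s * q) =
        (R : ℝ) ^ (-α) * (R : ℝ) ^ (d + α - s * q) * (R : ℝ) ^ (d + s * q) := by
      field_simp
    rw [this, ← Real.rpow_add hR0, ← Real.rpow_add hR0, ← pow_mul, ← Real.rpow_natCast]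
    congr 1
    push_cast
    ring
  have e3 : ((((R : ℝ) ^ n)⁻¹ / 8) ^ d * V / 2) * ((((R : ℝ) ^ (n + 1))⁻¹ / 8) ^ d * V / 2) =
      V ^ 2 / (4 * 64 ^ d * (R : ℝ) ^ d) / (((R : ℝ) ^ d) ^ n) ^ 2 := by
    have h64 : (64 : ℝ) ^ d = 8 ^ d * 8 ^ d := by rw [← mul_pow]; norm_num
    rw [h64, div_pow, div_pow, inv_pow, inv_pow, pow_succ, mul_pow, ← pow_mul, ← pow_mul,
      mul_comm n d]
    field_simp
    ring
  rw [e1, e2, e3]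
  set P := (((R : ℝ) ^ d) ^ n) ^ 2 with hP
  have hP0 : P ≠ 0 := by positivity
  set F := D ^ (d + s * q) with hF
  have hF0 : F ≠ 0 := (Real.rpow_pos_of_pos hD _).ne'
  set B := V ^ 2 / (4 * 64 ^ d * (R : ℝ) ^ d)
  calc _ = ((M : ℝ) ^ n * ((R : ℝ) ^ (-α)) ^ n * ((R : ℝ) ^ (d + α - s * q) / M) ^ n *
      ((R : ℝ) ^ (d + s * q)) ^ n) * (1 / q * δ ^ q / F * B) / P := by
        rw [div_div_eq_mul_div]; ring
    _ = _ := by rw [hkey]; field_simp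

/-- The key estimate: continuous functions equal to `1` on the outer ball of the one family
and to `0` on the outer ball of the other one have weighted energy bounded below. Along a branch
carrying little energy, the values cannot change much from one ball to the next, in either family.
But both families of balls along the branch converge to the same point. -/
lemma exists_le_phase_weight (hd : d ≠ 0) (hm : 1 ≤ m) (hR : 16 * m + 1 ≤ R) {s q α : ℝ}
    (hs : 0 < s) (hq : 0 < q) (hα : 0 < α)
    (hRm : (R : ℝ) ^ (d + α - s * q) < (m : ℝ) ^ d) :
    ∃ c : ℝ, 0 < c ∧ ∀ v : E d → ℝ, Continuous v → HasCompactSupport v →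
      (∀ x, ‖x - site i₀ 2 0‖ ≤ 1 / 8 → v x = 1) →
      (∀ x, ‖x - site i₀ (-2) 0‖ ≤ 1 / 8 → v x = 0) →
      ENNReal.ofReal c ≤ phase s q (weight R m i₀ α) v := by
  have hR1 : 1 < R := by omega
  have hR0 : (0 : ℝ) < R := by exact_mod_cast hR1.le
  have hRr : (1 : ℝ) < R := by exact_mod_cast hR1
  have hm0 : (0 : ℝ) < m := by exact_mod_cast hm
  set κ₀ : ℝ := (R : ℝ) ^ (d + α - s * q) / ((m ^ d : ℕ) : ℝ) with hκ₀
  have hκ₀0 : 0 < κ₀ := by positivity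
  have hκ₀1 : κ₀ < 1 := by
    rw [hκ₀, div_lt_one (by positivity)]; push_cast; exact hRm
  set σ := κ₀ ^ q⁻¹ with hσ
  have hσ0 : 0 < σ := Real.rpow_pos_of_pos hκ₀0 _
  have hσ1 : σ < 1 := Real.rpow_lt_one hκ₀0.le hκ₀1 (by positivity)
  have hσq : σ ^ q = κ₀ := Real.rpow_inv_rpow hκ₀0.le hq.ne'
  -- With this `δ` the drops `δ σ ^ n` add up to at most `1 / 3`.
  set δ := (1 - σ) / 3 with hδ
  have hδ0 : 0 < δ := by rw [hδ]; linarith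
  set V := (volume (Metric.ball (0 : E d) 1)).toReal with hV
  have hV0 : 0 < V := ENNReal.toReal_pos (Metric.measure_ball_pos _ _ one_pos).ne'
    measure_ball_lt_top.ne
  have hd0 : (0 : ℝ) < d := by exact_mod_cast Nat.pos_of_ne_zero hd
  set D : ℝ := 6 * d with hD
  have hD0 : 0 < D := by positivity
  refine ⟨1 / q * δ ^ q / D ^ (d + s * q) * (V ^ 2 / (4 * 64 ^ d * (R : ℝ) ^ d)), by positivity,
    fun v hv hvc h1 h0 => ?_⟩
  by_contra! hlt
  have hwm : Measurable (weight R m i₀ α : E d × E d → ℝ) := measurable_weight hR1 hα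
  have hdm := measurable_phaseDensity (σ := s) (r := q) hwm hv.measurable
  set μ : Measure (E d × E d) :=
    (volume.prod volume).withDensity (phaseDensity s q (weight R m i₀ α) v) with hμ
  have hμuniv : μ Set.univ = phase s q (weight R m i₀ α) v := by
    rw [hμ, withDensity_apply _ MeasurableSet.univ, Measure.restrict_univ,
      lintegral_prod _ hdm.aemeasurable]
    rfl
  obtain ⟨t, ht0, htn, htbox, htμ⟩ := exists_branch (d := d) hm hR μ
  have hball_box : ∀ κ : ℝ, (κ = 2 ∨ κ = -2) → ∀ n x, x ∈ siteBall R i₀ κ n (t n) →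
      x ∈ box R n (t n) := fun κ hκ n x hx =>
    mem_box_of_norm_sub_site_le (by rcases hκ with rfl | rfl <;> norm_num) hx
  have hImeas : ∀ κ n, MeasurableSet (siteBall R i₀ κ n (t n)) := fun κ n => by
    rw [siteBall_eq_closedBall hR1.le]; exact measurableSet_closedBall
  -- No drop by `δ σ ^ n` is possible between halves of consecutive balls.
  have hstep : ∀ κ : ℝ, (κ = 2 ∨ κ = -2) → ∀ n S S', MeasurableSet S → MeasurableSet S' →
      S ⊆ siteBall R i₀ κ n (t n) → S' ⊆ siteBall R i₀ κ (n + 1) (t (n + 1)) →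
      volume (siteBall R i₀ κ n (t n)) / 2 ≤ volume S →
      volume (siteBall R i₀ κ (n + 1) (t (n + 1))) / 2 ≤ volume S' →
      (∀ x ∈ S, ∀ y ∈ S', δ * σ ^ n ≤ |v x - v y|) → False := by
    intro κ hκ n S S' hS hS' hSI hSI' hvol hvol' hdrop
    set L : ℝ := 1 / q * ((R : ℝ) ^ (-α)) ^ n * (δ * σ ^ n) ^ q /
      (D * ((R : ℝ) ^ n)⁻¹) ^ (d + s * q) with hL
    have hL0 : 0 ≤ L := by positivity
    have hdens : ∀ z ∈ S ×ˢ S', ENNReal.ofReal L ≤ phaseDensity s q (weight R m i₀ α) v z := by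
      rintro ⟨x, y⟩ ⟨hx, hy⟩
      have hxy := hdrop x hx y hy
      have hne : 0 < ‖x - y‖ := by
        rw [norm_pos_iff, sub_ne_zero]
        rintro rfl
        rw [sub_self, abs_zero] at hxy
        exact absurd hxy (not_le.2 (by positivity))
      have hnorm : ‖x - y‖ ≤ D * ((R : ℝ) ^ n)⁻¹ :=
        norm_sub_le_of_mem_box hR1.le (hball_box κ hκ n x (hSI hx))
          (htbox n (hball_box κ hκ (n + 1) y (hSI' hy)))
      have hw := le_weight hR1 hα hκ (htn n) (htn (n + 1)) (hSI hx) (hSI' hy)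
      refine ENNReal.ofReal_le_ofReal ?_
      have hw0 := weight_nonneg (R := R) (m := m) (i₀ := i₀) (α := α) (x, y)
      refine div_le_div₀ (by positivity) ?_ (Real.rpow_pos_of_pos hne _) ?_
      · refine mul_le_mul (mul_le_mul_of_nonneg_left hw (by positivity)) ?_ (by positivity)
          (by positivity)
        exact Real.rpow_le_rpow (by positivity) hxy hq.le
      · exact Real.rpow_le_rpow (norm_nonneg _) hnorm (by positivity)
    have hμS : ENNReal.ofReal L * (volume S * volume S') ≤ μ (S ×ˢ S') := by
      rw [hμ, withDensity_apply _ (hS.prod hS'), ← Measure.prod_prod, ← setLIntegral_const]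
      exact setLIntegral_mono hdm hdens
    have hsub : S ×ˢ S' ⊆ box R n (t n) ×ˢ box R n (t n) := Set.prod_mono
      (fun x hx => hball_box κ hκ n x (hSI hx))
      (fun y hy => htbox n (hball_box κ hκ (n + 1) y (hSI' hy)))
    have hbig : ((m ^ d : ℕ) : ℝ≥0∞) ^ n * (ENNReal.ofReal L *
        (volume (siteBall R i₀ κ n (t n)) / 2 *
          (volume (siteBall R i₀ κ (n + 1) (t (n + 1))) / 2))) ≤
        phase s q (weight R m i₀ α) v := by
      calc _ ≤ ((m ^ d : ℕ) : ℝ≥0∞) ^ n * (ENNReal.ofReal L * (volume S * volume S')) := by gcongr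
        _ ≤ ((m ^ d : ℕ) : ℝ≥0∞) ^ n * μ (box R n (t n) ×ˢ box R n (t n)) := by
            gcongr
            exact hμS.trans (measure_mono hsub)
        _ ≤ _ := (htμ n).trans_eq hμuniv
    refine absurd hlt (not_lt.2 (le_trans (le_of_eq ?_) hbig))
    rw [volume_siteBall hR1.le, volume_siteBall hR1.le, ← hV,
      ← chain_constant_eq (M := m ^ d) (V := V) (by positivity) (by omega) hσ0 hδ0.le hD0 hσq n,
      ENNReal.ofReal_mul (by positivity), ENNReal.ofReal_mul hL0,
      ENNReal.ofReal_mul (by positivity), ENNReal.ofReal_div_of_pos two_pos,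
      ENNReal.ofReal_div_of_pos two_pos, ENNReal.ofReal_pow (by positivity),
      ENNReal.ofReal_natCast, ENNReal.ofReal_ofNat]
  have hsum : ∀ n, ∑ k ∈ Finset.range n, δ * σ ^ k ≤ 1 / 3 := by
    intro n
    rw [← Finset.mul_sum, hδ]
    have h2 : (∑ k ∈ Finset.range n, σ ^ k) * (1 - σ) = 1 - σ ^ n := geom_sum_mul_neg σ n
    have := pow_pos hσ0 n
    linarith
  have hpos : ∀ κ n, 0 < volume (siteBall R i₀ κ n (t n)) / 2 := by
    intro κ n
    rw [volume_siteBall hR1.le]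
    refine ENNReal.div_pos (ENNReal.ofReal_pos.2 ?_).ne' ENNReal.ofNat_ne_top
    positivity
  have hex : ∀ κ : ℝ, (κ = 2 ∨ κ = -2) → ∀ u : E d → ℝ, Measurable u →
      (∀ x y, |u x - u y| = |v x - v y|) → (∀ x ∈ siteBall R i₀ κ 0 (t 0), 1 ≤ u x) →
      ∀ n, ∃ x ∈ siteBall R i₀ κ n (t n), 2 / 3 ≤ u x := by
    intro κ hκ u hu huv hu0 n
    have h := half_measure_le_of_chain (μ := volume) (I := fun n => siteBall R i₀ κ n (t n))
      (hImeas κ) hu hu0 (δ := fun n => δ * σ ^ n) (fun n S S' h1 h2 h3 h4 h5 h6 h7 =>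
        hstep κ hκ n S S' h1 h2 h3 h4 h5 h6 fun x hx y hy => huv x y ▸ h7 x hx y hy) n
    obtain ⟨x, hx, hx'⟩ := nonempty_of_measure_ne_zero ((hpos κ n).trans_le h).ne'
    refine ⟨x, hx, ?_⟩
    have h1 : 1 - ∑ k ∈ Finset.range n, δ * σ ^ k ≤ u x := hx'
    linarith [hsum n]
  have hA := hex 2 (Or.inl rfl) v hv.measurable (fun _ _ => rfl) (fun x hx => by
    simp only [siteBall, pow_zero, one_smul, ht0, Set.mem_ofPred_eq] at hx
    rw [h1 x hx])
  have hB := hex (-2) (Or.inr rfl) (fun x => 1 - v x) (measurable_const.sub hv.measurable)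
    (fun x y => by rw [sub_sub_sub_cancel_left, abs_sub_comm]) (fun x hx => by
      simp only [siteBall, pow_zero, one_smul, ht0, Set.mem_ofPred_eq] at hx
      rw [h0 x hx, sub_zero])
  have huc : UniformContinuous v := hv.uniformContinuous_of_tendsto_cocompact (x := 0)
    hvc.is_zero_at_infty
  obtain ⟨ε, hε, hεv⟩ := Metric.uniformContinuous_iff.1 huc (1 / 3) (by norm_num)
  have htend : Filter.Tendsto (fun n => D * ((R : ℝ) ^ n)⁻¹) Filter.atTop (nhds 0) := by
    have := (tendsto_inv_atTop_zero.comp (tendsto_pow_atTop_atTop_of_one_lt hRr)).const_mul D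
    simpa using this
  obtain ⟨n, hn⟩ := (htend.eventually (gt_mem_nhds hε)).exists
  obtain ⟨x, hx, hvx⟩ := hA n
  obtain ⟨y, hy, hvy⟩ := hB n
  have hxy : dist x y < ε := by
    rw [dist_eq_norm]
    exact (norm_sub_le_of_mem_box hR1.le (hball_box 2 (Or.inl rfl) n x hx)
      (hball_box (-2) (Or.inr rfl) n y hy)).trans_lt hn
  have := hεv hxy
  rw [Real.dist_eq, abs_lt] at this
  linarith

end LowerBound

/-! ### The competitor and the boundary datum -/

/-- The choice of the Cantor set: its codimension `d - d log m / log R` lies strictly between `a` and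
`b`, and its pieces of one generation are far apart on their own scale. -/
lemma exists_parameters {d : ℕ} (hd : d ≠ 0) {a b : ℝ} (ha : 0 < a) (had : a < d) (hab : a < b) :
    ∃ R m : ℕ, 1 ≤ m ∧ 16 * m + 1 ≤ R ∧ (m : ℝ) ^ d * (R : ℝ) ^ (a - d) < 1 ∧
      (R : ℝ) ^ (d - b) < (m : ℝ) ^ d := by
  obtain ⟨β, haβ, hβ⟩ := exists_between (lt_min had hab)
  have hβd : β < d := hβ.trans_le (min_le_left _ _)
  have hβb : β < b := hβ.trans_le (min_le_right _ _)
  have hd0 : (0 : ℝ) < d := by exact_mod_cast Nat.pos_of_ne_zero hd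
  -- Taking `m` to be about `R ^ γ`, with `R` large, makes the codimension close to `β`.
  set γ := 1 - β / d with hγ
  have hγ0 : 0 < γ := by rw [hγ, sub_pos, div_lt_one hd0]; exact hβd
  have hγ1 : 0 < 1 - γ := by
    have : 0 < β / d := div_pos (ha.trans haβ) hd0
    rw [hγ]; linarith
  have hγd : γ * d = d - β := by rw [hγ]; field_simp
  have t1 : Filter.Tendsto (fun R : ℕ => (R : ℝ) ^ (1 - γ)) Filter.atTop Filter.atTop :=
    (tendsto_rpow_atTop hγ1).comp tendsto_natCast_atTop_atTop
  have t2 : Filter.Tendsto (fun R : ℕ => (2 : ℝ) ^ d * (R : ℝ) ^ (-(β - a))) Filter.atTop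
      (nhds 0) := by
    simpa using ((tendsto_rpow_neg_atTop (sub_pos.2 haβ)).comp
      tendsto_natCast_atTop_atTop).const_mul ((2 : ℝ) ^ d)
  obtain ⟨R, hR1, hR2, hR3⟩ := ((t1.eventually_ge_atTop 33).and
    ((t2.eventually (gt_mem_nhds one_pos)).and (Filter.eventually_gt_atTop 1))).exists
  have hR0 : (0 : ℝ) < R := by exact_mod_cast (by omega : 0 < R)
  have hRr : (1 : ℝ) < R := by exact_mod_cast hR3
  set X := (R : ℝ) ^ γ with hX
  have hX1 : 1 ≤ X := Real.one_le_rpow hRr.le hγ0.le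
  have hXd : X ^ d = (R : ℝ) ^ (d - β) := by
    rw [hX, ← Real.rpow_natCast, ← Real.rpow_mul hR0.le, hγd]
  have hm1 : X ≤ ⌈X⌉₊ := Nat.le_ceil X
  have hm2 : (⌈X⌉₊ : ℝ) ≤ 2 * X := by
    have := Nat.ceil_lt_add_one (by linarith : 0 ≤ X)
    linarith
  refine ⟨R, ⌈X⌉₊, ?_, ?_, ?_, ?_⟩
  · exact_mod_cast hX1.trans hm1
  · have hsplit : (R : ℝ) = (R : ℝ) ^ (1 - γ) * X := by
      rw [hX, ← Real.rpow_add hR0, sub_add_cancel, Real.rpow_one]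
    have h33 : 33 * X ≤ R := by
      rw [hsplit]; exact mul_le_mul_of_nonneg_right hR1 (by linarith)
    have : 16 * (⌈X⌉₊ : ℝ) + 1 ≤ R := by linarith
    exact_mod_cast this
  · calc (⌈X⌉₊ : ℝ) ^ d * (R : ℝ) ^ (a - d) ≤ (2 * X) ^ d * (R : ℝ) ^ (a - d) := by gcongr
      _ = 2 ^ d * (R : ℝ) ^ (-(β - a)) := by
          rw [mul_pow, hXd, mul_assoc, ← Real.rpow_add hR0]
          ring_nf
      _ < 1 := hR2
  · calc (R : ℝ) ^ (d - b) < (R : ℝ) ^ (d - β) := Real.rpow_lt_rpow_of_exponent_lt hRr (by linarith)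
      _ = X ^ d := hXd.symm
      _ ≤ _ := pow_le_pow_left₀ (by linarith) hm1 d

/-- The boundary datum, a bump about the outer ball of the family `κ = 2`. -/
def boundaryDatum {d : ℕ} (i₀ : Fin d) (x : E d) : ℝ := largeBump d (x - site i₀ 2 0)

/-- The discontinuous competitor: it equals `1` on all balls of the family `κ = 2` and `0` on all
balls of the family `κ = -2`. -/
def competitor {d : ℕ} (R m : ℕ) (i₀ : Fin d) (x : E d) : ℝ :=
  ⨆ i : Σ n, {t // t ∈ nodes d R m n}, largeBump d ((R : ℝ) ^ i.1 • x - site i₀ 2 i.2)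

section Competitor

variable {d R m : ℕ} {i₀ : Fin d}

instance : Nonempty (Σ n, {t // t ∈ nodes d R m n}) := ⟨⟨0, 0, zero_mem_nodes_zero⟩⟩

lemma contDiff_boundaryDatum : ContDiff ℝ ∞ (boundaryDatum i₀) :=
  (largeBump d).contDiff.comp (contDiff_id.sub contDiff_const)

lemma boundaryDatum_eq_zero_of_notMem_closedBall {x : E d}
    (hx : x ∉ Metric.closedBall (site i₀ 2 0) (1 / 2)) : boundaryDatum i₀ x = 0 := by
  by_contra h
  exact hx (by rw [Metric.mem_closedBall, dist_eq_norm]; exact norm_le_of_largeBump_ne_zero h)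

lemma boundaryDatum_eq_zero_of_notMem_cube {x : E d} (hx : x ∉ cube d 3) :
    boundaryDatum i₀ x = 0 := by
  by_contra h
  refine hx (mem_cube_three_of_norm_sub_site_le (R := 1) (m := 0) (n := 0) (i₀ := i₀) (κ := 2)
    le_rfl (by norm_num) zero_mem_nodes_zero ?_)
  simpa using norm_le_of_largeBump_ne_zero h

lemma boundaryDatum_eq_zero_of_near {x : E d} (hx : ‖x - site i₀ (-2) 0‖ ≤ 1 / 2) :
    boundaryDatum i₀ x = 0 := by
  by_contra h
  have h' := norm_le_of_largeBump_ne_zero h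
  refine site_families_disjoint (R := 1) (m := 0) (n := 0) (k := 0) (i₀ := i₀) (x := x) le_rfl
    zero_mem_nodes_zero zero_mem_nodes_zero ?_ ?_
  · simpa using h'
  · simpa using hx

lemma hasCompactSupport_boundaryDatum : HasCompactSupport (boundaryDatum i₀) :=
  HasCompactSupport.of_support_subset_isCompact
    (isCompact_closedBall (site i₀ 2 0) (1 / 2)) fun x hx => by
      by_contra h; exact hx (boundaryDatum_eq_zero_of_notMem_closedBall h)

lemma phase_boundaryDatum_lt_top {σ r M : ℝ} (hσ : 0 < σ) (hσ1 : σ < 1) (hr : 0 < r)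
    {w : E d × E d → ℝ} (hw : ∀ z, 0 ≤ w z) (hwM : ∀ z, w z ≤ M) :
    phase σ r w (boundaryDatum i₀) < ⊤ := by
  obtain ⟨L, hL⟩ := (contDiff_boundaryDatum (i₀ := i₀)).lipschitzWith_of_hasCompactSupport
    hasCompactSupport_boundaryDatum (by simp)
  refine phase_lt_top_of_lipschitz (Fin.pos i₀).ne' hσ hσ1 hr L.2 hw hwM
    (fun x => (largeBump d).nonneg) (fun x => (largeBump d).le_one) (fun x y => ?_)
    (B := Metric.closedBall (site i₀ 2 0) (1 / 2)) measurableSet_closedBall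
    measure_closedBall_lt_top.ne fun x => boundaryDatum_eq_zero_of_notMem_closedBall
  simpa [dist_eq_norm] using hL.dist_le_mul x y

lemma bddAbove_competitor (x : E d) : BddAbove (Set.range
    fun i : Σ n, {t // t ∈ nodes d R m n} =>
      largeBump d ((R : ℝ) ^ i.1 • x - site i₀ 2 i.2)) :=
  ⟨1, by rintro _ ⟨i, rfl⟩; exact (largeBump d).le_one⟩

lemma competitor_nonneg (x : E d) : 0 ≤ competitor R m i₀ x :=
  Real.iSup_nonneg fun _ => (largeBump d).nonneg

lemma competitor_le_one (x : E d) : competitor R m i₀ x ≤ 1 :=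
  ciSup_le fun _ => (largeBump d).le_one

lemma measurable_competitor : Measurable (competitor R m i₀) :=
  Measurable.iSup fun i => by
    have : Continuous fun x => largeBump d ((R : ℝ) ^ i.1 • x - site i₀ 2 i.2) :=
      (largeBump d).continuous.comp (by fun_prop)
    exact this.measurable

lemma competitor_eq_one {n : ℕ} {t : Fin d → ℕ} (ht : t ∈ nodes d R m n) {x : E d}
    (h : ‖(R : ℝ) ^ n • x - site i₀ 2 t‖ ≤ 1 / 4) : competitor R m i₀ x = 1 := by
  refine le_antisymm (competitor_le_one x) ?_
  rw [← largeBump_eq_one h]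
  exact le_ciSup (bddAbove_competitor x) (⟨n, t, ht⟩ : Σ n, {t // t ∈ nodes d R m n})

lemma competitor_eq_zero (hR : 16 * m + 1 ≤ R) {n : ℕ} {t : Fin d → ℕ} (ht : t ∈ nodes d R m n)
    {x : E d} (h : ‖(R : ℝ) ^ n • x - site i₀ (-2) t‖ ≤ 1 / 4) : competitor R m i₀ x = 0 := by
  refine le_antisymm (ciSup_le fun i => ?_) (competitor_nonneg x)
  by_contra! hc
  exact site_families_disjoint hR i.2.2 ht (norm_le_of_largeBump_ne_zero hc.ne')
    (h.trans (by norm_num))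

lemma competitor_eq_boundaryDatum (hm : 1 ≤ m) (hR : 16 * m + 1 ≤ R) {x : E d}
    (hx : x ∉ cube d 1) : competitor R m i₀ x = boundaryDatum i₀ x := by
  refine le_antisymm (ciSup_le fun i => ?_) ?_
  · obtain ⟨n, t, ht⟩ := i
    by_cases hn : n = 0
    · subst hn
      have : t = 0 := by
        funext i
        simpa [digits] using mem_nodes.1 ht i
      subst this
      simp [boundaryDatum]
    · by_contra! hc
      have h0 : largeBump d ((R : ℝ) ^ n • x - site i₀ 2 t) ≠ 0 :=
        (lt_of_le_of_lt (show 0 ≤ boundaryDatum i₀ x from (largeBump d).nonneg) hc).ne'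
      exact hx (mem_cube_one_of_norm_sub_site_le hm hR (by norm_num) hn ht
        (norm_le_of_largeBump_ne_zero h0))
  · have : _ ≤ competitor R m i₀ x := le_ciSup (bddAbove_competitor x)
      (⟨0, 0, zero_mem_nodes_zero⟩ : Σ n, {t // t ∈ nodes d R m n})
    simpa [boundaryDatum] using this

/-- The first phase of the competitor is finite: generation `n` consists of at most `m ^ (d n)`
bumps of scale `R ^ (-n)`, each of energy proportional to `R ^ ((s p - d) n)`. -/
lemma phase_competitor_lt_top {s p : ℝ} (hs : 0 < s) (hs1 : s < 1) (hp : 0 < p) (hR : 1 ≤ R)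
    (hRm : (m : ℝ) ^ d * (R : ℝ) ^ (s * p - d) < 1) :
    phase s p (fun _ => 1) (competitor R m i₀) < ⊤ := by
  have hR0 : (0 : ℝ) < R := by exact_mod_cast hR
  set f : (Σ n, {t // t ∈ nodes d R m n}) → E d → ℝ := fun i x =>
    largeBump d ((R : ℝ) ^ i.1 • x - site i₀ 2 i.2)
  have hfm : ∀ i, Measurable (f i) := fun i => by
    have : Continuous (f i) := (largeBump d).continuous.comp (by fun_prop)
    exact this.measurable
  set K := phase s p (fun _ => 1) (boundaryDatum i₀) with hK
  have hKtop : K < ⊤ := phase_boundaryDatum_lt_top hs hs1 hp (fun _ => zero_le_one) fun _ => le_rfl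
  have hKb : phase s p (fun _ => 1) (largeBump d : E d → ℝ) = K := by
    have h := phase_comp_smul_sub (σ := s) (r := p) one_pos (site i₀ 2 0)
      (largeBump d : E d → ℝ)
    simp only [one_smul, Real.one_rpow, ENNReal.ofReal_one, one_mul] at h
    exact h.symm
  set θ := (m : ℝ) ^ d * (R : ℝ) ^ (s * p - d) with hθ
  have hθ0 : 0 ≤ θ := by positivity
  have hphase : ∀ i, phase s p (fun _ => 1) (f i) =
      ENNReal.ofReal (((R : ℝ) ^ (s * p - d)) ^ i.1) * K := fun i => by
    rw [← hKb, Real.rpow_pow_comm hR0.le]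
    exact phase_comp_smul_sub (pow_pos hR0 _) _ _
  have hgen : ∀ n, ∑' t : {t // t ∈ nodes d R m n}, phase s p (fun _ => 1) (f ⟨n, t⟩) ≤
      ENNReal.ofReal (θ ^ n) * K := by
    intro n
    simp_rw [hphase]
    rw [tsum_fintype, Finset.sum_const, nsmul_eq_mul, Finset.card_univ, Fintype.card_coe,
      ← mul_assoc]
    refine mul_le_mul_left ?_ K
    rw [hθ, mul_pow, ENNReal.ofReal_mul (by positivity)]
    refine mul_le_mul_left ?_ _
    rw [← ENNReal.ofReal_natCast]
    refine ENNReal.ofReal_le_ofReal ?_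
    exact_mod_cast card_nodes_le d R m n
  calc phase s p (fun _ => 1) (competitor R m i₀) ≤ ∑' i, phase s p (fun _ => 1) (f i) :=
        phase_iSup_le_tsum hp (fun _ => zero_le_one) measurable_const hfm
          fun i x => (largeBump d).le_one
    _ = ∑' n, ∑' t : {t // t ∈ nodes d R m n}, phase s p (fun _ => 1) (f ⟨n, t⟩) :=
        ENNReal.tsum_sigma' _
    _ ≤ ∑' n, ENNReal.ofReal (θ ^ n) * K := ENNReal.tsum_le_tsum hgen
    _ = ENNReal.ofReal (∑' n, θ ^ n) * K := by
        rw [ENNReal.tsum_mul_right, ENNReal.ofReal_tsum_of_nonneg (fun n => pow_nonneg hθ0 n)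
          (summable_geometric_of_lt_one hθ0 hRm)]
    _ < ⊤ := ENNReal.mul_lt_top ENNReal.ofReal_lt_top hKtop

/-- The second phase of the competitor vanishes, since the weight only couples balls of the same
family, on which the competitor is constant. -/
lemma phase_weight_competitor (hR : 16 * m + 1 ≤ R) {t q α : ℝ} (hq : 0 < q) :
    phase t q (weight R m i₀ α) (competitor R m i₀) = 0 := by
  rw [phase_eq_lintegral_phaseDensity]
  have : ∀ x y, phaseDensity t q (weight R m i₀ α) (competitor R m i₀) (x, y) = 0 := by
    intro x y
    by_cases hw : weight R m i₀ α (x, y) = 0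
    · simp [phaseDensity, hw]
    · obtain ⟨κ, hκ, ⟨k, s, hs, h1⟩, k', s', hs', h2⟩ := exists_near_sites_of_weight_ne_zero hw
      have heq : competitor R m i₀ x = competitor R m i₀ y := by
        rcases hκ with rfl | rfl
        · rw [competitor_eq_one hs h1, competitor_eq_one hs' h2]
        · rw [competitor_eq_zero hR hs h1, competitor_eq_zero hR hs' h2]
      simp [phaseDensity, heq, Real.zero_rpow hq.ne']
  simp [this]

end Competitor

lemma phase_neg {d : ℕ} {σ r : ℝ} {w : E d × E d → ℝ} (f : E d → ℝ) :
    phase σ r w (-f) = phase σ r w f := by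
  unfold phase
  refine lintegral_congr fun x => lintegral_congr fun y => ?_
  rw [Pi.neg_apply, Pi.neg_apply, neg_sub_neg, abs_sub_comm]

/-- A lower bound for the second phase on `u_D + C_0^∞(Ω)` passes, up to a constant, to the
closure `H_{u_D}(Ω)`. -/
lemma le_phase_of_mem_H {d : ℕ} {e : Exponents} {a : E d × E d → ℝ} {Ω : Set (E d)}
    {uD : E d → ℝ} {c : ℝ} (hc : 0 < c) (hq : 0 < e.q) (ha : ∀ z, 0 ≤ a z) (ham : Measurable a)
    (huD : Continuous uD)
    (h : ∀ φ ∈ testFunctions Ω, ENNReal.ofReal c ≤ phase e.t e.q a (uD + φ))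
    {v : E d → ℝ} (hv : v ∈ H e a Ω uD) :
    ENNReal.ofReal (c / 2 / 2 ^ e.q) ≤ phase e.t e.q a v := by
  obtain ⟨⟨hloc, -, -⟩, happ⟩ := hv
  have h2 : (0 : ℝ) < 2 ^ e.q := by positivity
  set η := (c / 2 / 2 ^ e.q) ^ e.q⁻¹ with hη
  have hη0 : 0 < η := by positivity
  have hηq : 2 ^ e.q * η ^ e.q = c / 2 := by
    rw [hη, Real.rpow_inv_rpow (by positivity) hq.ne']; field_simp
  obtain ⟨φ, hφ, hlux⟩ := happ (ENNReal.ofReal η) (ENNReal.ofReal_pos.2 hη0)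
  simp only [luxNorm, iInf_lt_iff] at hlux
  -- The error of the approximation contributes at most `2 ^ q * η ^ q = c / 2`.
  obtain ⟨l, hl0, hle, hlη⟩ := hlux
  rw [ENNReal.ofReal_lt_ofReal_iff hη0] at hlη
  set g := v - uD - φ with hg
  have hvm : AEStronglyMeasurable v volume := by
    have := hloc.aestronglyMeasurable.add huD.aestronglyMeasurable
    simpa using this
  have hgl : phase e.t e.q a g ≤ ENNReal.ofReal (η ^ e.q) := by
    rw [phase_eq_rpow_mul_phase_div hl0]
    calc _ ≤ ENNReal.ofReal (l ^ e.q) * 1 := by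
          refine mul_le_mul_right (le_trans ?_ hle) _
          exact le_add_self
      _ ≤ _ := by
          rw [mul_one]
          exact ENNReal.ofReal_le_ofReal (Real.rpow_le_rpow hl0.le hlη.le hq.le)
  have hsum : uD + φ = v + -g := by rw [hg]; abel
  have hle2 : ENNReal.ofReal c ≤
      ENNReal.ofReal (2 ^ e.q) * phase e.t e.q a v + ENNReal.ofReal (c / 2) := by
    calc ENNReal.ofReal c ≤ phase e.t e.q a (v + -g) := hsum ▸ h φ hφ
      _ ≤ ENNReal.ofReal (2 ^ e.q) * (phase e.t e.q a v + phase e.t e.q a (-g)) :=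
          phase_add_le hq ha ham hvm
      _ ≤ ENNReal.ofReal (2 ^ e.q) * (phase e.t e.q a v + ENNReal.ofReal (η ^ e.q)) := by
          rw [phase_neg]; gcongr
      _ = _ := by rw [mul_add, ← ENNReal.ofReal_mul h2.le, hηq]
  rcases eq_or_ne (phase e.t e.q a v) ⊤ with htop | htop
  · rw [htop]; exact le_top
  rw [ENNReal.ofReal_le_iff_le_toReal htop]
  rw [← ENNReal.ofReal_toReal htop, ← ENNReal.ofReal_mul h2.le,
    ← ENNReal.ofReal_add (by positivity) (by positivity),
    ENNReal.ofReal_le_ofReal_iff (by positivity)] at hle2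
  rw [div_le_iff₀ h2]
  linarith

lemma competitor_mem_W {d R m : ℕ} {i₀ : Fin d} (hm : 1 ≤ m) (hR : 16 * m + 1 ≤ R)
    {e : Exponents} (hs : 0 < e.s) (hs1 : e.s < 1) (hp : 0 < e.p) (ht : 0 < e.t) (ht1 : e.t < 1)
    (hq : 0 < e.q) {a : E d × E d → ℝ} (ha : ∀ z, 0 ≤ a z) {M : ℝ} (haM : ∀ z, a z ≤ M)
    (ham : Measurable a) (h1 : phase e.s e.p (fun _ => 1) (competitor R m i₀) < ⊤)
    (h2 : phase e.t e.q a (competitor R m i₀) < ⊤) :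
    competitor R m i₀ ∈ W e a (cube d 1) (boundaryDatum i₀) := by
  have hcm := (measurable_competitor (R := R) (m := m) (i₀ := i₀))
  have hum : Measurable (boundaryDatum i₀) := contDiff_boundaryDatum.continuous.measurable
  refine ⟨?_, ?_, Filter.Eventually.of_forall fun x hx => ?_⟩
  · refine (memLp_top_of_bound (hcm.sub hum).aestronglyMeasurable 1
      (Filter.Eventually.of_forall fun x => ?_)).locallyIntegrable le_top
    have a1 := competitor_nonneg (R := R) (m := m) (i₀ := i₀) x
    have a2 := competitor_le_one (R := R) (m := m) (i₀ := i₀) x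
    have a3 : 0 ≤ boundaryDatum i₀ x := (largeBump d).nonneg
    have a4 : boundaryDatum i₀ x ≤ 1 := (largeBump d).le_one
    rw [Pi.sub_apply, Real.norm_eq_abs, abs_le]
    constructor <;> linarith
  · rw [sub_eq_add_neg]
    refine ENNReal.add_lt_top.2 ⟨?_, ?_⟩
    · refine (phase_add_le hp (fun _ => zero_le_one) measurable_const
        hcm.aestronglyMeasurable).trans_lt ?_
      rw [phase_neg]
      exact ENNReal.mul_lt_top ENNReal.ofReal_lt_top (ENNReal.add_lt_top.2
        ⟨h1, phase_boundaryDatum_lt_top hs hs1 hp (fun _ => zero_le_one) fun _ => le_rfl⟩)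
    · refine (phase_add_le hq ha ham hcm.aestronglyMeasurable).trans_lt ?_
      rw [phase_neg]
      exact ENNReal.mul_lt_top ENNReal.ofReal_lt_top (ENNReal.add_lt_top.2
        ⟨h2, phase_boundaryDatum_lt_top ht ht1 hq ha haM⟩)
  · rw [Pi.sub_apply, competitor_eq_boundaryDatum hm hR hx, sub_self]

end DoublePhase

end

open DoublePhase

theorem theorem4p1 (d : ℕ) (s t p q α : ℝ)
    (hp : 1 < p) (hq : 1 < q) (hs : 0 < s) (hst : s ≤ t) (ht : t < 1)
    (hsub : s - d / p < 0) (hα : 0 < α) (h : s * p + α < t * q) :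
    ∃ a : DoublePhase.E d × DoublePhase.E d → ℝ,
      (∀ z, 0 ≤ a z) ∧
      (∃ M : ℝ, ∀ z, a z ≤ M) ∧
      (∀ x y, a (x, y) = a (y, x)) ∧
      (∀ x y, x ∉ DoublePhase.cube d 3 ∨ y ∉ DoublePhase.cube d 3 → a (x, y) = 0) ∧
      DoublePhase.HolderClass α a ∧
      DoublePhase.LavrentievGap { s := s, p := p, t := t, q := q } a := by
  have hp0 : 0 < p := by linarith
  have hq0 : 0 < q := by linarith
  have ht0 : 0 < t := by linarith
  have hspd : s * p < d := by
    have : s < d / p := by linarith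
    rwa [lt_div_iff₀ hp0] at this
  have hd : d ≠ 0 := by
    rintro rfl
    have := mul_pos hs hp0
    simp only [Nat.cast_zero] at hspd
    linarith
  obtain ⟨α', hαα', hα'⟩ := exists_between (by linarith : α < t * q - s * p)
  have hα'0 : 0 < α' := hα.trans hαα'
  obtain ⟨R, m, hm, hR, hRm1, hRm2⟩ := exists_parameters hd (mul_pos hs hp0) hspd
    (by linarith : s * p < t * q - α')
  have hR1 : 1 < R := by omega
  set i₀ : Fin d := ⟨0, Nat.pos_of_ne_zero hd⟩
  obtain ⟨c, hc, hcv⟩ := exists_le_phase_weight (i₀ := i₀) hd hm hR ht0 hq0 hα'0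
    (by rwa [show (d : ℝ) + α' - t * q = d - (t * q - α') by ring])
  obtain ⟨M, hM⟩ := exists_weight_le (R := R) (m := m) (i₀ := i₀) hR1 hα'0
  set u := competitor R m i₀
  set K := phase s p (fun _ => 1) u
  have hK : K < ⊤ := phase_competitor_lt_top hs (by linarith) hp0 hR1.le hRm1
  -- The factor makes the second phase on `H` exceed the energy `K` of the competitor.
  set l := (K.toReal + 1) * (2 * 2 ^ q) / c
  have hl : 0 < l := by positivity
  set a : E d × E d → ℝ := fun z => l * weight R m i₀ α' z
  have ha : ∀ z, 0 ≤ a z := fun z => mul_nonneg hl.le (weight_nonneg z)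
  have haM : ∀ z, a z ≤ l * M := fun z => mul_le_mul_of_nonneg_left (hM z) hl.le
  have ham : Measurable a := (measurable_weight hR1 hα'0).const_mul l
  have hu2 : phase t q a u = 0 := by
    rw [phase_const_mul_weight hl.le, phase_weight_competitor hR hq0, mul_zero]
  refine ⟨a, ha, ⟨l * M, haM⟩, fun x y => ?_, fun x y hxy => ?_,
    holderClass_const_mul_weight hR1 i₀ hα hαα' l, boundaryDatum i₀, contDiff_boundaryDatum,
    fun x hx => boundaryDatum_eq_zero_of_notMem_cube hx, ?_⟩
  · simp only [a]; rw [weight_swap]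
  · simp only [a]; rw [weight_eq_zero_of_notMem hR hxy, mul_zero]
  · have huW : u ∈ W ⟨s, p, t, q⟩ a (cube d 1) (boundaryDatum i₀) :=
      competitor_mem_W hm hR hs (by simp only; linarith) hp0 ht0 ht hq0 ha haM ham hK
        (hu2.trans_lt ENNReal.zero_lt_top)
    have hW : (⨅ v ∈ W ⟨s, p, t, q⟩ a (cube d 1) (boundaryDatum i₀),
        energy ⟨s, p, t, q⟩ a v) ≤ K := by
      refine (iInf₂_le u huW).trans_eq ?_
      simp only [energy]
      rw [hu2, add_zero]
    have htest : ∀ φ ∈ testFunctions (cube d 1),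
        ENNReal.ofReal (l * c) ≤ phase t q a (boundaryDatum i₀ + φ) := by
      rintro φ ⟨hφ, hφc, hφs⟩
      have hφ0 : ∀ x, x ∉ cube d 1 → φ x = 0 := fun x hx =>
        image_eq_zero_of_notMem_tsupport fun h => hx (hφs h)
      rw [phase_const_mul_weight hl.le, ENNReal.ofReal_mul hl.le]
      refine mul_le_mul_right (hcv _ (contDiff_boundaryDatum.continuous.add hφ.continuous)
        (hasCompactSupport_boundaryDatum.add hφc) (fun x hx => ?_) fun x hx => ?_) _
      · rw [Pi.add_apply, hφ0 x (notMem_cube_one_of_norm_sub_site_zero_le (κ := 2) (by norm_num)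
          (hx.trans (by norm_num))), add_zero]
        exact largeBump_eq_one (hx.trans (by norm_num))
      · rw [Pi.add_apply, hφ0 x (notMem_cube_one_of_norm_sub_site_zero_le (κ := -2) (by norm_num)
          (hx.trans (by norm_num))), add_zero]
        exact boundaryDatum_eq_zero_of_near (hx.trans (by norm_num))
    have hH : ENNReal.ofReal (K.toReal + 1) ≤
        ⨅ v ∈ H ⟨s, p, t, q⟩ a (cube d 1) (boundaryDatum i₀), energy ⟨s, p, t, q⟩ a v := by
      refine le_iInf₂ fun v hv => ?_
      have := le_phase_of_mem_H (e := ⟨s, p, t, q⟩) (mul_pos hl hc) hq0 ha ham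
        contDiff_boundaryDatum.continuous htest hv
      have hval : l * c / 2 / 2 ^ q = K.toReal + 1 := by
        simp only [l]; field_simp
      simp only [hval] at this
      exact this.trans le_add_self
    refine hW.trans_lt (lt_of_lt_of_le ?_ hH)
    rw [ENNReal.lt_ofReal_iff_toReal_lt hK.ne]
    linarith
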